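/- Work in the first-order language of groups $\{1,\,{}^{-1},\,\cdot\}$. For a group $G$ and a finite tuple $\bar a$ of elements of $G$, the $\forall$-type of $\bar a$ in $G$ is the set of universal formulas $\varphi(\bar z)=\forall \bar y\,\psi(\bar y,\bar z)$ ($\psi$ quantifier-free) such that $G\models\varphi(\bar a)$. The group $G$ is $\forall$-homogeneous if any two finite tuples of $G$ of the same length with the same $\forall$-type in $G$ are carried one to the other by an automorphism of $G$. A subgroup $H\le G$ is existentially closed in $G$ if every finite tuple of $H$ has the same $\forall$-type in $H$ as in $G$. An element of a free group is primitive if it belongs to a free basis. **Theorem.** (1) A free group whose rank is finite and at least $3$, or countably infinite, is not $\forall$-homogeneous: it contains two finite tuples of the same length with the same $\forall$-type such that no automorphism carries one to the other. (2) Explicit witnesses in ranks $4$ and $3$ are as follows. Let $n\ge 1$ and $m\ge 2$ be integers, let $u=x^2(bx^{2n})^m$, and let $L_2=\langle a,b,x,t \mid [u,t]=1\rangle$. Write $g^t=t^{-1}gt$ and $h=bx^{2n}$, and consider the subgroups $L=\langle a,b\rangle$, $M=\langle a,\,b,\,x^2,\,b^t,\,x^t\rangle$ and $M_3=\langle h,\,b^t,\,x^t\rangle$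 of $L_2$. Then: - $L$ is free with basis $\{a,b\}$, and $M$ is free of rank $4$ with basis $\{a,h,b^t,x^t\}$. - $L\le M$, and $L$ is existentially closed in $M$ but is not a free factor of $M$. - $b,h\in M$; the pairs $(a,b)$ and $(a,h)$ have the same $\forall$-type in $M$, the element $b$ is not primitive in $M$, and no automorphism of $M$ carries $(a,b)$ to $(a,h)$. - $M_3$ is free of rank $3$ with basis $\{h,b^t,x^t\}$ and contains $b$; the elements $b$ and $h$ have the same $\forall$-type in $M_3$, $h$ is primitive in $M_3$ but $b$ is not, and no automorphism of $M_3$ carries $b$ to $h$. -/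

import Mathlib

universe u

open FirstOrder

namespace FreeHom

/-! ## Universal types in the first-order language of groups -/

/-- The function symbols of the language of groups. -/
inductive GroupFunc : ℕ → Type
  | one : GroupFunc 0
  | inv : GroupFunc 1
  | mul : GroupFunc 2

/-- The first-order language of groups: a constant `1`, a unary symbol for the inverse, a binary
symbol for the product, and no relation symbols besides equality. -/
def groupLang : Language where
  Functions := GroupFunc
  Relations := fun _ => Empty

/-- Every group, with its own operations, is a structure for the language of groups. -/
instance groupStructure (G : Type*) [Group G] : groupLang.Structure G where
  funMap := fun {_} f =>
    match f with
    | GroupFunc.one => fun _ => 1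
    | GroupFunc.inv => fun v => (v 0)⁻¹
    | GroupFunc.mul => fun v => v 0 * v 1
  RelMap := fun {_} r => Empty.elim r

/-- The `∀`-type of a tuple in the group `G`: the set of universal formulas (blocks of universal
quantifiers in front of a quantifier-free formula) that hold in `G` at this tuple. -/
def forallType {G : Type*} [Group G] {k : ℕ} (v : Fin k → G) : Set (groupLang.Formula (Fin k)) :=
  {φ | Language.BoundedFormula.IsUniversal φ ∧ φ.Realize v}

/-- `G` is `∀`-homogeneous: finite tuples of the same length with the same `∀`-type lie in one
orbit of the automorphism group. -/
def IsForallHomogeneous (G : Type*) [Group G] : Prop :=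
  ∀ (k : ℕ) (v w : Fin k → G), forallType v = forallType w → ∃ σ : G ≃* G, ∀ i, σ (v i) = w i

/-- The subgroup `H` is existentially closed in `G`: every finite tuple of elements of `H` has the
same `∀`-type in `H` as in `G`. -/
def IsExistentiallyClosed {G : Type*} [Group G] (H : Subgroup G) : Prop :=
  ∀ (k : ℕ) (v : Fin k → H), forallType v = forallType (fun i => (v i : G))

/-! ## Free factors and primitive elements -/

/-- `H` is a free factor of `G`: `G` is the internal free product of `H` and another subgroup. -/
def IsFreeFactor {G : Type*} [Group G] (H : Subgroup G) : Prop :=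
  ∃ K : Subgroup G, Function.Bijective (Monoid.Coprod.lift H.subtype K.subtype)

/-- `g` is primitive in `G`: it is a member of some free basis of `G`. -/
def IsPrimitive {G : Type u} [Group G] (g : G) : Prop :=
  ∃ (ι : Type u) (B : FreeGroupBasis ι G) (i : ι), B i = g

/-! ## The explicit groups -/

/-- The letters `a, b, x, t`. -/
inductive Letter : Type
  | a | b | x | t

open Letter in
/-- The word `u = x ^ 2 (b x ^ (2 n)) ^ m`. -/
def wordU (n m : ℕ) : FreeGroup Letter :=
  FreeGroup.of x ^ 2 * (FreeGroup.of b * FreeGroup.of x ^ (2 * n)) ^ m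

/-- The group `L₂ = ⟨a, b, x, t ∣ [u, t] = 1⟩` where `u = x ^ 2 (b x ^ (2 n)) ^ m`. -/
abbrev LTwo (n m : ℕ) : Type :=
  PresentedGroup
    ({wordU n m * FreeGroup.of Letter.t * (wordU n m)⁻¹ * (FreeGroup.of Letter.t)⁻¹} :
      Set (FreeGroup Letter))

section
variable (n m : ℕ)

/-- The element `a` of `L₂`. -/
def gA : LTwo n m := PresentedGroup.of Letter.a
/-- The element `b` of `L₂`. -/
def gB : LTwo n m := PresentedGroup.of Letter.b
/-- The element `x` of `L₂`. -/
def gX : LTwo n m := PresentedGroup.of Letter.x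
/-- The stable letter `t` of `L₂`. -/
def gT : LTwo n m := PresentedGroup.of Letter.t
/-- The element `h = b x ^ (2 n)` of `L₂`. -/
def gH : LTwo n m := gB n m * gX n m ^ (2 * n)
/-- The conjugate `b ^ t = t⁻¹ b t`. -/
def gBt : LTwo n m := (gT n m)⁻¹ * gB n m * gT n m
/-- The conjugate `x ^ t = t⁻¹ x t`. -/
def gXt : LTwo n m := (gT n m)⁻¹ * gX n m * gT n m

/-- `L = ⟨a, b⟩`. -/
def subL : Subgroup (LTwo n m) := Subgroup.closure {gA n m, gB n m}

/-- `M₁ = ⟨a, b, x ^ 2⟩`. -/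
def subMOne : Subgroup (LTwo n m) := Subgroup.closure {gA n m, gB n m, gX n m ^ 2}

/-- `M₂ = ⟨b ^ t, x ^ t⟩`. -/
def subMTwo : Subgroup (LTwo n m) := Subgroup.closure {gBt n m, gXt n m}

/-- `M`, the subgroup of `L₂` generated by `M₁` and `M₂`. -/
def subM : Subgroup (LTwo n m) := subMOne n m ⊔ subMTwo n m

/-- `M₃ = ⟨b x ^ (2 n), b ^ t, x ^ t⟩`. -/
def subMThree : Subgroup (LTwo n m) := Subgroup.closure {gH n m, gBt n m, gXt n m}

end

end FreeHom

/-!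
All assertions follow from one notion. A homomorphism `i : H → G` is *discriminated* if for every
finite set of nontrivial elements of `G` some retraction of `G` onto `H` kills none of them. A
counterexample in `G` to a universal formula with parameters in `H` involves finitely many
inequalities of terms, and survives a retraction that preserves them; so tuples of `H` have the same
`∀`-type in `H` and in `G` (`IsDiscriminated.forallType_eq`).

Free factors of finite rank at least two of a free group are discriminated (`isDiscriminated_map`),
and so is `⟨a, b⟩` in the free group on `a, h, c, y`, where `c` and `y` stand for `bᵗ` and `xᵗ`, and
`b` is the word `h (hᵐ w⁻¹)ⁿ` with `w = y² (c y²ⁿ)ᵐ` (`isDiscriminated_iotaTwo`). Hence `(a, b)` and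
`(a, h)` have the same `∀`-type, and so have `b` and `h` in the free group on `h, c, y`, or in any
free group having it as a free factor.

The second discrimination goes through the homomorphisms `phi`, which factor through `L₂` by
`t ↦ uᵏ`. That they are eventually nontrivial on each nontrivial element also shows that
`a, h, bᵗ, xᵗ` are free generators of `M` (`theta_injective`), so that no normal form theorem for
`L₂` is needed. Both discriminations rest on the same argument
(`IsAlternating.eventually_ne_one`). Write an element as an alternating product of factors from two
subgroups, represent free groups faithfully by integer matrices (ping-pong with strong
transvections, `lift_transvection_injective`), and let the exponent `k` tend to infinity: the
rescaled product converges to a product of matrices of rank one, which is nonzero provided that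
certain matrix entries are. For the free factors, these entries are nonzero after a generic
conjugation. For `phi`, they are nonzero unless the factor commutes with `u`, by the discreteness of
`SL₂(ℤ)`; and `u = x² hᵐ` generates its centralizer (`mem_zpowers_uThree`).

That `b` is not primitive is seen on affine actions on the complex line. A member of a basis acts
nontrivially in some affine action with any prescribed linear part, and so does a member of a basis
of a free factor. But when `y`, `c`, `h` act with linear parts nontrivial roots of unity of orders
dividing `2`, `m` and `n m + 1`, the powers `y²`, `(c y²ⁿ)ᵐ` and `h ^ (n m + 1)` are trivial, hence
so is `b` (`exists_character_bWord`).
-/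

namespace FreeHom

/-! ### Discriminating families of retractions and universal types -/

/-- The homomorphism `i : H →* G` is discriminated: for every finite set of nontrivial elements of
`G` some retraction of `G` onto `H` (a left inverse of `i`) kills none of them. -/
def IsDiscriminated {H G : Type*} [Group H] [Group G] (i : H →* G) : Prop :=
  ∀ S : Finset G, (∀ s ∈ S, s ≠ 1) →
    ∃ r : G →* H, (∀ x, r (i x) = x) ∧ ∀ s ∈ S, r s ≠ 1

/-- A group homomorphism, as a homomorphism of structures for the language of groups. -/
def toLanguageHom {G H : Type*} [Group G] [Group H] (f : G →* H) : G →[groupLang] H where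
  toFun := f
  map_fun' := by
    intro n F x
    cases F
    · exact map_one f
    · exact map_inv f _
    · exact map_mul f _ _
  map_rel' := by
    intro n R
    exact Empty.elim R

theorem realize_term_map {G H : Type*} [Group G] [Group H] (f : G →* H) {α : Type*}
    (t : groupLang.Term α) (v : α → G) : t.realize (f ∘ v) = f (t.realize v) :=
  Language.HomClass.realize_term (toLanguageHom f)

/-- A quantifier-free formula keeps its truth value under every homomorphism that avoids killing
finitely many elements, namely the values of the differences `t₁ t₂⁻¹` of the terms it compares. -/
theorem exists_finset_realize_qf {G : Type*} [Group G] {α : Type*} {n : ℕ}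
    {φ : groupLang.BoundedFormula α n} (hφ : φ.IsQF) (v : α → G) (xs : Fin n → G) :
    ∃ S : Finset G, (∀ s ∈ S, s ≠ 1) ∧ ∀ (H : Type*) [Group H] (r : G →* H),
      (∀ s ∈ S, r s ≠ 1) → (φ.Realize (r ∘ v) (r ∘ xs) ↔ φ.Realize v xs) := by
  classical
  induction hφ with
  | falsum => exact ⟨∅, by simp, fun _ _ _ _ => Iff.rfl⟩
  | of_isAtomic h =>
    cases h with
    | equal t₁ t₂ =>
      set d := t₁.realize (Sum.elim v xs) * (t₂.realize (Sum.elim v xs))⁻¹ with hd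
      refine ⟨if d = 1 then ∅ else {d}, ?_, ?_⟩
      · intro s hs
        split_ifs at hs with h
        · simp at hs
        · rw [Finset.mem_singleton.1 hs]; exact h
      · intro H _ r hr
        rw [Language.BoundedFormula.realize_bdEqual, Language.BoundedFormula.realize_bdEqual,
          ← Sum.comp_elim, realize_term_map, realize_term_map]
        refine ⟨fun h => ?_, fun h => by rw [h]⟩
        by_contra hne
        have hd1 : d ≠ 1 := fun h1 => hne (mul_inv_eq_one.1 h1)
        refine hr d (by rw [if_neg hd1]; simp) ?_
        rw [hd, map_mul, map_inv, h, mul_inv_cancel]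
    | rel R ts => exact Empty.elim R
  | imp _ _ ih₁ ih₂ =>
    obtain ⟨S₁, h₁, h₁'⟩ := ih₁
    obtain ⟨S₂, h₂, h₂'⟩ := ih₂
    refine ⟨S₁ ∪ S₂, fun s hs => (Finset.mem_union.1 hs).elim (h₁ s) (h₂ s), fun H _ r hr => ?_⟩
    rw [Language.BoundedFormula.realize_imp, Language.BoundedFormula.realize_imp,
      h₁' H r (fun s hs => hr s (Finset.mem_union_left _ hs)),
      h₂' H r (fun s hs => hr s (Finset.mem_union_right _ hs))]

/-- A counterexample to a universal formula survives every homomorphism that avoids killing a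
suitable finite set of nontrivial elements. -/
theorem exists_finset_not_realize {G : Type*} [Group G] {α : Type*} {n : ℕ}
    {φ : groupLang.BoundedFormula α n} (hφ : φ.IsUniversal) (v : α → G) (xs : Fin n → G)
    (hn : ¬ φ.Realize v xs) :
    ∃ S : Finset G, (∀ s ∈ S, s ≠ 1) ∧ ∀ (H : Type*) [Group H] (r : G →* H),
      (∀ s ∈ S, r s ≠ 1) → ¬ φ.Realize (r ∘ v) (r ∘ xs) := by
  induction hφ with
  | of_isQF h =>
    obtain ⟨S, h1, h2⟩ := exists_finset_realize_qf h v xs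
    exact ⟨S, h1, fun H _ r hr => (h2 H r hr).not.2 hn⟩
  | all h ih =>
    rw [Language.BoundedFormula.realize_all] at hn
    push Not at hn
    obtain ⟨x, hx⟩ := hn
    obtain ⟨S, h1, h2⟩ := ih (Fin.snoc xs x) hx
    refine ⟨S, h1, fun H _ r hr hall => h2 H r hr ?_⟩
    rw [Language.BoundedFormula.realize_all] at hall
    rw [Fin.comp_snoc]
    exact hall (r x)

/-- Universal formulas are inherited along embeddings. -/
theorem realize_of_injective {G H : Type*} [Group G] [Group H] {f : H →* G}
    (hf : Function.Injective f) {α : Type*} {n : ℕ} {φ : groupLang.BoundedFormula α n}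
    (hφ : φ.IsUniversal) {v : α → H} {xs : Fin n → H} (h : φ.Realize (f ∘ v) (f ∘ xs)) :
    φ.Realize v xs :=
  hφ.realize_embedding (F := H ↪[groupLang] G)
    { toLanguageHom f with
      inj' := hf
      map_rel' := fun {_} R => Empty.elim R } h

namespace IsDiscriminated

variable {H G K : Type*} [Group H] [Group G] [Group K]

theorem injective {i : H →* G} (h : IsDiscriminated i) : Function.Injective i := by
  obtain ⟨r, hr, -⟩ := h ∅ (by simp)
  exact Function.LeftInverse.injective hr

theorem forallType_eq {i : H →* G} (h : IsDiscriminated i) {k : ℕ} (v : Fin k → H) :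
    forallType v = forallType (i ∘ v) := by
  ext φ
  refine and_congr_right fun hφ => ⟨fun hv => ?_, fun hv => ?_⟩
  · by_contra hn
    obtain ⟨S, h1, h2⟩ := exists_finset_not_realize hφ (i ∘ v) default hn
    obtain ⟨r, hr, hr'⟩ := h S h1
    refine h2 H r hr' ?_
    have : r ∘ i ∘ v = v := funext fun j => hr (v j)
    rw [this, Subsingleton.elim (r ∘ default) default]
    exact hv
  · refine realize_of_injective h.injective hφ ?_
    rw [Subsingleton.elim (i ∘ default) default]
    exact hv

theorem trans {i : H →* G} {j : G →* K} (hi : IsDiscriminated i) (hj : IsDiscriminated j) :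
    IsDiscriminated (j.comp i) := by
  classical
  intro S hS
  obtain ⟨r, hr, hr'⟩ := hj S hS
  obtain ⟨q, hq, hq'⟩ := hi (S.image r) (by
    intro s hs
    obtain ⟨t, ht, rfl⟩ := Finset.mem_image.1 hs
    exact hr' t ht)
  exact ⟨q.comp r, fun x => by simp [hr, hq],
    fun s hs => hq' _ (Finset.mem_image_of_mem r hs)⟩

theorem of_mulEquiv (e : H ≃* G) : IsDiscriminated e.toMonoidHom := fun S hS =>
  ⟨e.symm.toMonoidHom, fun x => by simp, fun s hs => by simpa using hS s hs⟩

end IsDiscriminated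

/-- The image of a discriminated homomorphism is an existentially closed subgroup. -/
theorem IsDiscriminated.isExistentiallyClosed {H G : Type*} [Group H] [Group G] {i : H →* G}
    (h : IsDiscriminated i) (K : Subgroup G) (hK : i.range = K) : IsExistentiallyClosed K := by
  subst hK
  intro k v
  choose w hw using fun j => (v j).2
  have h1 := (IsDiscriminated.of_mulEquiv (MonoidHom.ofInjective h.injective)).forallType_eq w
  have h2 := h.forallType_eq w
  have hv : (MonoidHom.ofInjective h.injective).toMonoidHom ∘ w = v :=
    funext fun j => Subtype.ext (hw j)
  have hv' : i ∘ w = fun j => (v j : G) := funext hw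
  rw [hv] at h1
  rw [hv'] at h2
  exact h1.symm.trans h2

/-! ### Free groups of unipotent integer matrices -/

/-- The determinant of the `2 × 2` matrix with columns `v` and `w`. -/
def wedge (v w : Fin 2 → ℤ) : ℤ := v 0 * w 1 - v 1 * w 0

/-- The unipotent matrix `w ↦ w + t (v ∧ w) v`, which fixes `v`. -/
def transvection (v : Fin 2 → ℤ) (t : ℤ) : Matrix.SpecialLinearGroup (Fin 2) ℤ :=
  ⟨!![1 - t * (v 0 * v 1), t * (v 0 * v 0); -(t * (v 1 * v 1)), 1 + t * (v 0 * v 1)], by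
    rw [Matrix.det_fin_two_of]; ring⟩

theorem transvection_mul (v : Fin 2 → ℤ) (s t : ℤ) :
    transvection v s * transvection v t = transvection v (s + t) := by
  ext i j
  rw [Matrix.SpecialLinearGroup.coe_mul, Matrix.mul_apply, Fin.sum_univ_two]
  fin_cases i <;> fin_cases j <;> simp [transvection] <;> ring

theorem transvection_zero (v : Fin 2 → ℤ) : transvection v 0 = 1 := by
  ext i j
  fin_cases i <;> fin_cases j <;> simp [transvection]

/-- The transvections along `v` form a one-parameter group. -/
def transvectionHom (v : Fin 2 → ℤ) :
    Multiplicative ℤ →* Matrix.SpecialLinearGroup (Fin 2) ℤ where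
  toFun t := transvection v t.toAdd
  map_one' := transvection_zero v
  map_mul' _ _ := (transvection_mul v _ _).symm

theorem transvection_zpow (v : Fin 2 → ℤ) (t e : ℤ) :
    transvection v t ^ e = transvection v (e * t) := by
  have := map_zpow (transvectionHom v) (Multiplicative.ofAdd t) e
  rw [← ofAdd_zsmul, smul_eq_mul] at this
  exact this.symm

theorem transvection_pow (v : Fin 2 → ℤ) (t : ℤ) (e : ℕ) :
    transvection v t ^ e = transvection v (e * t) := by
  rw [← zpow_natCast, transvection_zpow]

theorem transvection_mulVec (v : Fin 2 → ℤ) (t : ℤ) (w : Fin 2 → ℤ) :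
    (transvection v t : Matrix (Fin 2) (Fin 2) ℤ).mulVec w = w + (t * wedge v w) • v := by
  ext i
  fin_cases i <;>
    simp [transvection, Matrix.mulVec, dotProduct, Fin.sum_univ_two, wedge] <;> ring

/-- Strong transvections along pairwise independent directions generate a free group: the vectors
closer to the direction `v i` than to all the others form the `i`-th ping-pong domain. -/
theorem lift_transvection_injective {κ : Type*} [Nontrivial κ] (v : κ → Fin 2 → ℤ) (t : κ → ℤ)
    (D : ℤ) (hv : ∀ i j, i ≠ j → wedge (v i) (v j) ≠ 0)
    (hD : ∀ i j, |wedge (v i) (v j)| ≤ D) (ht : ∀ i, 2 * D + 1 < |t i|) :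
    Function.Injective (FreeGroup.lift fun i => transvection (v i) (t i)) := by
  let _ : MulAction (Matrix.SpecialLinearGroup (Fin 2) ℤ) (Fin 2 → ℤ) :=
    { smul := fun g w => (g : Matrix (Fin 2) (Fin 2) ℤ).mulVec w
      one_smul := fun w => Matrix.one_mulVec w
      mul_smul := fun g h w => (Matrix.mulVec_mulVec w g.1 h.1).symm }
  have hsmul : ∀ (g : Matrix.SpecialLinearGroup (Fin 2) ℤ) (w : Fin 2 → ℤ),
      g • w = (g : Matrix (Fin 2) (Fin 2) ℤ).mulVec w := fun _ _ => rfl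
  have hcomp : FreeGroup.lift (fun i => transvection (v i) (t i)) =
      (Monoid.CoprodI.lift fun i : κ => FreeGroup.lift fun _ : Unit =>
        transvection (v i) (t i)).comp (@freeGroupEquivCoprodI κ).toMonoidHom := by
    ext i
    simp
  rw [hcomp, MonoidHom.coe_comp]
  refine Function.Injective.comp ?_ (MulEquiv.injective freeGroupEquivCoprodI)
  refine Monoid.CoprodI.lift_injective_of_ping_pong _ ?_
    (fun i => {w | ∀ l, l ≠ i → |wedge (v i) w| < |wedge (v l) w|}) ?_ ?_ ?_
  · refine Or.inr ⟨(exists_pair_ne κ).choose, ?_⟩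
    rw [Cardinal.mk_congr FreeGroup.freeGroupUnitEquivInt, Cardinal.mk_int]
    exact (Cardinal.natCast_lt_aleph0 (n := 3)).le
  · intro i
    refine ⟨v i, fun l hl => ?_⟩
    have h0 : wedge (v i) (v i) = 0 := by simp only [wedge]; ring
    rw [h0, abs_zero]
    exact abs_pos.2 (hv l i hl)
  · intro i j hij
    refine Set.disjoint_left.2 fun w h1 h2 => ?_
    exact lt_asymm (h1 j hij.symm) (h2 i hij)
  · intro i j hij g hg
    obtain ⟨e, rfl⟩ := FreeGroup.freeGroupUnitEquivInt.symm.surjective g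
    have he : e ≠ 0 := by
      rintro rfl
      exact hg rfl
    have hact : FreeGroup.lift (fun _ : Unit => transvection (v i) (t i))
        (FreeGroup.freeGroupUnitEquivInt.symm e) = transvection (v i) (e * t i) := by
      rw [← transvection_zpow]
      change FreeGroup.lift _ (FreeGroup.of () ^ e) = _
      simp
    rw [hact]
    rintro _ ⟨w, hw, rfl⟩ l hl
    have hyx := hw i hij
    change |wedge (v i) (transvection (v i) (e * t i) • w)| <
      |wedge (v l) (transvection (v i) (e * t i) • w)|
    rw [hsmul, transvection_mulVec]
    set x := wedge (v i) w
    set y := wedge (v j) w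
    set W := wedge (v l) (v i) with hW
    have e1 : wedge (v i) (w + (e * t i * x) • v i) = x := by
      simp only [wedge, x, Pi.add_apply, Pi.smul_apply, smul_eq_mul]
      ring
    have e2 : wedge (v l) (w + (e * t i * x) • v i) = wedge (v l) w + e * t i * x * W := by
      simp only [wedge, hW, Pi.add_apply, Pi.smul_apply, smul_eq_mul]
      ring
    rw [e1, e2]
    have hx : 0 < |x| := (abs_nonneg y).trans_lt hyx
    -- the Plücker relation bounds `v l ∧ w` by the two other coordinates of `w`
    have hpl : wedge (v i) (v j) * wedge (v l) w =
        wedge (v i) (v l) * y - wedge (v j) (v l) * x := by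
      simp only [wedge, x, y]
      ring
    have hb : |wedge (v l) w| ≤ 2 * D * |x| := by
      have h1 : 1 ≤ |wedge (v i) (v j)| := Int.one_le_abs (hv i j hij)
      calc |wedge (v l) w| ≤ |wedge (v i) (v j)| * |wedge (v l) w| :=
            le_mul_of_one_le_left (abs_nonneg _) h1
        _ = |wedge (v i) (v l) * y - wedge (v j) (v l) * x| := by rw [← abs_mul, hpl]
        _ ≤ |wedge (v i) (v l)| * |y| + |wedge (v j) (v l)| * |x| := by
            rw [← abs_mul, ← abs_mul]; exact abs_sub _ _
        _ ≤ D * |x| + D * |x| := by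
            gcongr
            · exact (abs_nonneg _).trans (hD i l)
            · exact hD i l
            · exact hD j l
        _ = 2 * D * |x| := by ring
    have hbig : (2 * D + 1) * |x| < |e * t i * x * W| := by
      have h1 : 1 ≤ |W| := Int.one_le_abs (hv l i hl)
      have h2 : 1 ≤ |e| := Int.one_le_abs he
      rw [abs_mul, abs_mul, abs_mul]
      calc (2 * D + 1) * |x| < |t i| * |x| := by
            exact mul_lt_mul_of_pos_right (ht i) hx
        _ ≤ |e| * (|t i| * |x|) := le_mul_of_one_le_left (by positivity) h2
        _ ≤ |e| * (|t i| * |x|) * |W| := le_mul_of_one_le_right (by positivity) h1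
        _ = |e| * |t i| * |x| * |W| := by ring
    have htri : |e * t i * x * W| ≤ |wedge (v l) w + e * t i * x * W| + |wedge (v l) w| := by
      have := abs_sub (wedge (v l) w + e * t i * x * W) (wedge (v l) w)
      rwa [add_sub_cancel_left] at this
    linarith

/-! ### Alternating products and their dominant terms -/

section Alternating

open Filter Topology Matrix

variable {G : Type*} [Group G]

/-- Products `q₁ p₁ q₂ p₂ ⋯ q_r p_r` with `r ≥ 1`, `q_i ∈ Q \ C`, `p_i ∈ P`, and `p_i ∉ C` for
`i < r`: the reduced forms in an amalgam of `P` and `Q` over `C` that begin in `Q`. -/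
inductive IsAlternating (P Q C : Subgroup G) : G → Prop
  | base {q p : G} (hq : q ∈ Q) (hqC : q ∉ C) (hp : p ∈ P) : IsAlternating P Q C (q * p)
  | cons {q p g : G} (hq : q ∈ Q) (hqC : q ∉ C) (hp : p ∈ P) (hpC : p ∉ C)
      (hg : IsAlternating P Q C g) : IsAlternating P Q C (q * p * g)

theorem mem_or_exists_isAlternating {P Q C : Subgroup G} (hPQ : P ⊔ Q = ⊤) (hCP : C ≤ P)
    (hCQ : C ≤ Q) (g : G) : g ∈ P ∨ ∃ p ∈ P, ∃ w, IsAlternating P Q C w ∧ g = p * w := by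
  have hP : ∀ x ∈ P, ∀ g, (g ∈ P ∨ ∃ p ∈ P, ∃ w, IsAlternating P Q C w ∧ g = p * w) →
      (x * g ∈ P ∨ ∃ p ∈ P, ∃ w, IsAlternating P Q C w ∧ x * g = p * w) := by
    rintro x hx g (hg | ⟨p, hp, w, hw, rfl⟩)
    · exact Or.inl (mul_mem hx hg)
    · exact Or.inr ⟨x * p, mul_mem hx hp, w, hw, (mul_assoc _ _ _).symm⟩
  have hQ : ∀ x ∈ Q, ∀ g, (g ∈ P ∨ ∃ p ∈ P, ∃ w, IsAlternating P Q C w ∧ g = p * w) →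
      (x * g ∈ P ∨ ∃ p ∈ P, ∃ w, IsAlternating P Q C w ∧ x * g = p * w) := by
    intro x hx g hg
    by_cases hxC : x ∈ C
    · exact hP x (hCP hxC) g hg
    rcases hg with hg | ⟨p, hp, w, hw, rfl⟩
    · exact Or.inr ⟨1, one_mem _, x * g, .base hx hxC hg, (one_mul _).symm⟩
    by_cases hpC : p ∈ C
    · cases hw with
      | @base q p' hq hqC hp' =>
        have hx' : x * p * q ∈ Q := mul_mem (mul_mem hx (hCQ hpC)) hq
        have e : x * (p * (q * p')) = x * p * q * p' := by group
        rw [e]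
        by_cases hC : x * p * q ∈ C
        · exact Or.inl (mul_mem (hCP hC) hp')
        · exact Or.inr ⟨1, one_mem _, _, .base hx' hC hp', (one_mul _).symm⟩
      | @cons q p' g hq hqC hp' hpC' hg =>
        have hx' : x * p * q ∈ Q := mul_mem (mul_mem hx (hCQ hpC)) hq
        have e : x * (p * (q * p' * g)) = x * p * q * p' * g := by group
        rw [e]
        by_cases hC : x * p * q ∈ C
        · exact Or.inr ⟨_, mul_mem (hCP hC) hp', g, hg, rfl⟩
        · exact Or.inr ⟨1, one_mem _, _, .cons hx' hC hp' hpC' hg, (one_mul _).symm⟩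
    · exact Or.inr ⟨1, one_mem _, x * p * w, .cons hx hxC hp hpC hw, by group⟩
  have hg : g ∈ Subgroup.closure ((P : Set G) ∪ Q) := by
    rw [← Subgroup.sup_eq_closure, hPQ]
    trivial
  induction hg using Subgroup.closure_induction_left with
  | one => exact Or.inl (one_mem _)
  | mul_left x hx y _ ih => exact hx.elim (fun h => hP x h y ih) (fun h => hQ x h y ih)
  | inv_mul_cancel x hx y _ ih =>
    exact hx.elim (fun h => hP _ (inv_mem h) y ih) (fun h => hQ _ (inv_mem h) y ih)

theorem vecMul_ne_zero {η : Fin 2 → ℝ} (hη : η ≠ 0) (Φ : G →* Matrix (Fin 2) (Fin 2) ℝ) (p : G) :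
    η ᵥ* Φ p ≠ 0 := by
  intro h
  have h1 : (η ᵥ* Φ p) ᵥ* Φ p⁻¹ = η := by
    rw [Matrix.vecMul_vecMul, ← map_mul, mul_inv_cancel, map_one, Matrix.vecMul_one]
  rw [h, Matrix.zero_vecMul] at h1
  exact hη h1.symm

variable {P Q C : Subgroup G} {J : Type*} {l : Filter J}
  {Φ : J → ℕ → G →* Matrix (Fin 2) (Fin 2) ℝ} {π : G → Matrix (Fin 2) (Fin 2) ℝ}
  {c : ℕ → ℝ} {ξ η : J → Fin 2 → ℝ}

/-- If, after division by `c k`, the factors from `Q \ C` converge to nonzero multiples of one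
matrix `ξ ηᵀ` of rank one, then the rescaled alternating product has a nonzero limit, provided that
the factors `p ∈ P \ C` satisfy `ηᵀ p ξ ≠ 0`. -/
theorem IsAlternating.exists_tendsto
    (hη : ∀ j, η j ≠ 0) (hP : ∀ p ∈ P, ∀ j k, Φ j k p = π p)
    (hQ : ∀ q ∈ Q, q ∉ C → ∀ j, ∃ a : ℝ, a ≠ 0 ∧
      Tendsto (fun k => (c k)⁻¹ • Φ j k q) atTop (𝓝 (a • vecMulVec (ξ j) (η j))))
    (hPC : ∀ p ∈ P, p ∉ C → ∀ᶠ j in l, η j ⬝ᵥ (π p *ᵥ ξ j) ≠ 0)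
    {w : G} (hw : IsAlternating P Q C w) :
    ∀ᶠ j in l, ∃ r : ℕ, ∃ ζ : Fin 2 → ℝ, ζ ≠ 0 ∧
      Tendsto (fun k => ((c k)⁻¹) ^ (r + 1) • Φ j k w) atTop (𝓝 (vecMulVec (ξ j) ζ)) := by
  induction hw with
  | @base q p hq hqC hp =>
    refine Eventually.of_forall fun j => ?_
    obtain ⟨a, ha, hlim⟩ := hQ q hq hqC j
    refine ⟨0, a • (η j ᵥ* π p), ?_, ?_⟩
    · rw [← hP p hp j 0]
      exact smul_ne_zero ha (vecMul_ne_zero (hη j) _ p)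
    · have h := hlim.mul (tendsto_const_nhds (x := π p))
      rw [Matrix.smul_mul, vecMulVec_mul, ← vecMulVec_smul] at h
      refine h.congr fun k => ?_
      rw [zero_add, pow_one, map_mul, hP p hp, Matrix.smul_mul]
  | @cons q p g hq hqC hp hpC _ ih =>
    filter_upwards [ih, hPC p hp hpC] with j ⟨r, ζ, hζ, hlim'⟩ hpj
    obtain ⟨a, ha, hlim⟩ := hQ q hq hqC j
    refine ⟨r + 1, (a * (η j ⬝ᵥ (π p *ᵥ ξ j))) • ζ, smul_ne_zero (mul_ne_zero ha hpj) hζ, ?_⟩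
    have h := (hlim.mul (tendsto_const_nhds (x := π p))).mul hlim'
    rw [Matrix.smul_mul, vecMulVec_mul, Matrix.smul_mul, vecMulVec_mul_vecMulVec,
      ← dotProduct_mulVec, ← vecMulVec_smul, smul_smul] at h
    refine h.congr fun k => ?_
    rw [map_mul, map_mul, hP p hp, Matrix.smul_mul, Matrix.smul_mul, Matrix.mul_smul, smul_smul,
      pow_succ' _ (r + 1)]

/-- Under the hypotheses on dominant terms, a product of an element of `P` and an alternating
product is eventually not mapped to the identity. -/
theorem IsAlternating.eventually_ne_one
    (hc : Tendsto c atTop atTop) (hξ : ∀ j, ξ j ≠ 0)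
    (hη : ∀ j, η j ≠ 0) (hP : ∀ p ∈ P, ∀ j k, Φ j k p = π p)
    (hQ : ∀ q ∈ Q, q ∉ C → ∀ j, ∃ a : ℝ, a ≠ 0 ∧
      Tendsto (fun k => (c k)⁻¹ • Φ j k q) atTop (𝓝 (a • vecMulVec (ξ j) (η j))))
    (hPC : ∀ p ∈ P, p ∉ C → ∀ᶠ j in l, η j ⬝ᵥ (π p *ᵥ ξ j) ≠ 0)
    {p w : G} (hp : p ∈ P) (hw : IsAlternating P Q C w) :
    ∀ᶠ j in l, ∀ᶠ k in atTop, Φ j k (p * w) ≠ 1 := by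
  filter_upwards [hw.exists_tendsto hη hP hQ hPC] with j ⟨r, ζ, hζ, hlim⟩
  by_contra hcon
  rw [not_eventually] at hcon
  have h0 : Tendsto (fun k => ((c k)⁻¹) ^ (r + 1) • π p⁻¹) atTop (𝓝 0) := by
    have h := (hc.inv_tendsto_atTop.pow (r + 1)).smul_const (π p⁻¹)
    rwa [zero_pow r.succ_ne_zero, zero_smul] at h
  have heq : ∃ᶠ k in atTop, ((c k)⁻¹) ^ (r + 1) • Φ j k w = ((c k)⁻¹) ^ (r + 1) • π p⁻¹ := by
    refine hcon.mono fun k hk => ?_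
    rw [not_not, map_mul] at hk
    rw [← hP p⁻¹ (inv_mem hp) j k]
    congr 1
    calc Φ j k w = Φ j k p⁻¹ * Φ j k p * Φ j k w := by rw [← map_mul, inv_mul_cancel]; simp
      _ = Φ j k p⁻¹ := by rw [mul_assoc, hk, mul_one]
  have hz : vecMulVec (ξ j) ζ = 0 := tendsto_nhds_unique_of_frequently_eq hlim h0 heq
  obtain ⟨x, hx⟩ := Function.ne_iff.1 (hξ j)
  obtain ⟨y, hy⟩ := Function.ne_iff.1 hζ
  have := congrFun (congrFun hz x) y
  rw [vecMulVec_apply] at this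
  exact mul_ne_zero hx hy this

end Alternating

/-! ### Free factors are discriminated -/

section FreeFactor

open Filter Topology Matrix

/-- Integer unimodular matrices as real matrices. -/
def realMatrix : Matrix.SpecialLinearGroup (Fin 2) ℤ →* Matrix (Fin 2) (Fin 2) ℝ where
  toFun g := (g : Matrix (Fin 2) (Fin 2) ℤ).map (Int.castRingHom ℝ)
  map_one' := by simp
  map_mul' g h := by rw [Matrix.SpecialLinearGroup.coe_mul, Matrix.map_mul]

theorem realMatrix_apply (g : Matrix.SpecialLinearGroup (Fin 2) ℤ) (i j : Fin 2) :
    realMatrix g i j = ((g i j : ℤ) : ℝ) := rfl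

theorem realMatrix_transvection (v : Fin 2 → ℤ) (t : ℤ) :
    realMatrix (transvection v t) =
      1 + (t : ℝ) • vecMulVec (fun i => (v i : ℝ)) ![-(v 1 : ℝ), (v 0 : ℝ)] := by
  ext i j
  rw [realMatrix_apply]
  fin_cases i <;> fin_cases j <;> simp [transvection, -mul_eq_mul_left_iff] <;> ring

theorem transvection_conj (v w : Fin 2 → ℤ) (s t : ℤ) :
    transvection w s * transvection v t * transvection w (-s) =
      transvection (v + (s * wedge w v) • w) t := by
  ext i j
  rw [Matrix.SpecialLinearGroup.coe_mul, Matrix.SpecialLinearGroup.coe_mul]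
  simp only [Matrix.mul_apply, Fin.sum_univ_two]
  fin_cases i <;> fin_cases j <;> simp [transvection, wedge] <;> ring

theorem eventually_quadratic_ne_zero (a b c : ℤ) (h : ¬ (a = 0 ∧ b = 0 ∧ c = 0)) :
    ∀ᶠ j : ℕ in atTop, a + b * j + c * (j : ℤ) ^ 2 ≠ 0 := by
  open Polynomial in
  let p : ℤ[X] := C a + C b * X + C c * X ^ 2
  have hp : p ≠ 0 := by
    intro h0
    refine h ⟨?_, ?_, ?_⟩
    · simpa [p] using congrArg (Polynomial.coeff · 0) h0
    · simpa [p, Polynomial.coeff_X, Polynomial.coeff_C, -eq_intCast] using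
        congrArg (Polynomial.coeff · 1) h0
    · simpa [p, Polynomial.coeff_X, Polynomial.coeff_C, -eq_intCast] using
        congrArg (Polynomial.coeff · 2) h0
  rw [← Nat.cofinite_eq_atTop]
  refine ((Polynomial.finite_setOfPred_isRoot hp).preimage
    (Nat.cast_injective (R := ℤ)).injOn).eventually_cofinite_notMem.mono fun j hj h0 => hj ?_
  simpa [p, Polynomial.IsRoot] using h0

theorem sq_eq_one_of_scalar (g : Matrix.SpecialLinearGroup (Fin 2) ℤ) (h10 : g 1 0 = 0)
    (h01 : g 0 1 = 0) (hd : g 0 0 = g 1 1) : g ^ 2 = 1 := by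
  have hdet := Matrix.det_fin_two g.1
  rw [g.2] at hdet
  ext i j
  rw [pow_two, Matrix.SpecialLinearGroup.coe_mul]
  simp only [Matrix.mul_apply, Fin.sum_univ_two]
  fin_cases i <;> fin_cases j <;>
    simp_all

/-- A free group of finite rank at least two is discriminated in the free group with one more
basis element `x`: the retractions `x ↦ β⁻ʲ αᵏ βʲ`, for two basis elements `α` and `β`, do not
kill a given nontrivial element once `j` is large and `k` is large in terms of `j`. -/
theorem isDiscriminated_map_some (κ : Type*) [Finite κ] [Nontrivial κ] :
    IsDiscriminated (FreeGroup.map (some : κ → Option κ)) := by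
  obtain ⟨n, ⟨e⟩⟩ := Finite.exists_equiv_fin κ
  have hn : 2 ≤ n := by
    have h1 : 1 < Nat.card κ := Finite.one_lt_card
    rw [Nat.card_congr e, Nat.card_fin] at h1
    exact h1
  -- `n` bounds the determinants `v i ∧ v j` below, so ping-pong needs `T > 2 n + 1`
  set T : ℤ := 2 * n + 2 with hT
  have hT0 : T ≠ 0 := by omega
  let v : κ → Fin 2 → ℤ := fun i => ![1, ((e i : ℕ) : ℤ)]
  let ρ := FreeGroup.lift fun i => transvection (v i) T
  have hw : ∀ i j, wedge (v i) (v j) = ((e j : ℕ) : ℤ) - (e i : ℕ) := fun i j => by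
    simp [wedge, v]
  have hρ : Function.Injective ρ := by
    refine lift_transvection_injective v (fun _ => T) n (fun i j hij => ?_) (fun i j => ?_)
      fun _ => ?_
    · rw [hw, sub_ne_zero]
      intro h
      exact hij (e.injective (Fin.ext (by exact_mod_cast h.symm)))
    · have h1 := (e i).2
      have h2 := (e j).2
      rw [hw, abs_le]
      constructor <;> omega
    · rw [abs_of_pos] <;> omega
  let α : κ := e.symm ⟨0, by omega⟩
  let β : κ := e.symm ⟨1, by omega⟩
  have hα : v α = ![1, 0] := by simp [v, α]
  have hβ : v β = ![1, 1] := by simp [v, β]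
  let r : ℕ → ℕ → FreeGroup (Option κ) →* FreeGroup κ := fun j k =>
    FreeGroup.lift fun o => o.elim
      (FreeGroup.of β ^ (-(j : ℤ)) * FreeGroup.of α ^ (k : ℤ) * FreeGroup.of β ^ (j : ℤ))
      FreeGroup.of
  have hr : ∀ j k x, r j k (FreeGroup.map some x) = x := by
    intro j k x
    have : (r j k).comp (FreeGroup.map some) = MonoidHom.id _ := by
      ext i
      simp [r]
    exact DFunLike.congr_fun this x
  -- the direction fixed by the image of `β⁻ʲ α βʲ`
  let ξ : ℕ → Fin 2 → ℤ := fun j => ![1 + j * T, j * T]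
  have hρr : ∀ (j k : ℕ) (m : ℤ), ρ (r j k (FreeGroup.of none ^ m)) =
      transvection (ξ j) (m * (k * T)) := by
    intro j k m
    have h1 : ρ (r j k (FreeGroup.of none)) = transvection (ξ j) (k * T) := by
      simp only [r, ρ, FreeGroup.lift_apply_of, Option.elim, map_mul, map_zpow,
        transvection_zpow]
      rw [show (j : ℤ) * T = -(-(j : ℤ) * T) by ring, transvection_conj, hα, hβ]
      congr 1
      ext i
      fin_cases i <;> simp [ξ, wedge]
    rw [map_zpow, map_zpow, h1, transvection_zpow]
  let P : Subgroup (FreeGroup (Option κ)) := (FreeGroup.map some).range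
  let Q : Subgroup (FreeGroup (Option κ)) := Subgroup.zpowers (FreeGroup.of none)
  have hPQ : P ⊔ Q = ⊤ := by
    rw [eq_top_iff, ← FreeGroup.closure_range_of, Subgroup.closure_le]
    rintro _ ⟨o, rfl⟩
    cases o with
    | none => exact Subgroup.mem_sup_right (Subgroup.mem_zpowers _)
    | some i => exact Subgroup.mem_sup_left ⟨FreeGroup.of i, by simp⟩
  let Φ : ℕ → ℕ → FreeGroup (Option κ) →* Matrix (Fin 2) (Fin 2) ℝ := fun j k =>
    realMatrix.comp (ρ.comp (r j k))
  have key : ∀ s : FreeGroup (Option κ), s ≠ 1 → ∀ᶠ j in atTop, ∀ᶠ k in atTop, r j k s ≠ 1 := by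
    intro s hs
    rcases mem_or_exists_isAlternating hPQ bot_le bot_le s with ⟨x, rfl⟩ | ⟨p, hp, w, hw', rfl⟩
    · refine Eventually.of_forall fun j => Eventually.of_forall fun k => ?_
      rw [hr]
      rintro rfl
      exact hs (map_one _)
    have := hw'.eventually_ne_one (l := atTop) (Φ := Φ) (π := Φ 0 0) (c := fun k => (k : ℝ))
      (ξ := fun j i => (ξ j i : ℝ)) (η := fun j => ![-(ξ j 1 : ℝ), (ξ j 0 : ℝ)])
      tendsto_natCast_atTop_atTop ?_ ?_ ?_ ?_ ?_ hp
    · filter_upwards [this] with j hj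
      filter_upwards [hj] with k hk h1
      exact hk (by simp [Φ, h1])
    · intro j h0
      have h1 := congrFun h0 0
      have h2 := congrFun h0 1
      simp only [ξ, Pi.zero_apply, Matrix.cons_val_zero, Matrix.cons_val_one,
        Int.cast_eq_zero] at h1 h2
      omega
    · intro j h0
      have h1 := congrFun h0 0
      have h2 := congrFun h0 1
      simp only [ξ, Pi.zero_apply, Matrix.cons_val_zero, Matrix.cons_val_one,
        neg_eq_zero, Int.cast_eq_zero] at h1 h2
      omega
    · rintro _ ⟨x, rfl⟩ j k
      simp only [Φ, MonoidHom.comp_apply, hr]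
    · rintro _ ⟨m, rfl⟩ hm j
      have hm0 : m ≠ 0 := by
        rintro rfl
        exact hm (by simp)
      refine ⟨m * T, by exact_mod_cast mul_ne_zero hm0 hT0, ?_⟩
      have hlim : Tendsto (fun k : ℕ => (k : ℝ)⁻¹ • (1 : Matrix (Fin 2) (Fin 2) ℝ) +
          ((m : ℝ) * T) • vecMulVec (fun i => (ξ j i : ℝ)) ![-(ξ j 1 : ℝ), (ξ j 0 : ℝ)]) atTop
          (𝓝 ((0 : ℝ) • 1 +
            ((m : ℝ) * T) • vecMulVec (fun i => (ξ j i : ℝ)) ![-(ξ j 1 : ℝ), (ξ j 0 : ℝ)])) :=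
        (tendsto_inv_atTop_nhds_zero_nat.smul_const _).add_const _
      rw [zero_smul, zero_add] at hlim
      refine hlim.congr' ?_
      filter_upwards [eventually_ne_atTop 0] with k hk
      have hk' : (k : ℝ) ≠ 0 := by exact_mod_cast hk
      change _ = (k : ℝ)⁻¹ • realMatrix (ρ (r j k (FreeGroup.of none ^ m)))
      rw [hρr, realMatrix_transvection, smul_add, smul_smul]
      congr 2
      push_cast
      field_simp
    · rintro _ ⟨x, rfl⟩ hx
      have hx1 : x ≠ 1 := by
        rintro rfl
        exact hx (by simp)
      set g := ρ x with hg
      -- the determinant of `ξ j` and `g ξ j` is a quadratic polynomial in `j`; it vanishes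
      -- identically only if `g` is scalar, and then `g² = 1` contradicts torsion-freeness
      have hne := eventually_quadratic_ne_zero (g 1 0) ((2 * g 1 0 - g 0 0 + g 1 1) * T)
        ((g 1 0 + g 1 1 - g 0 0 - g 0 1) * T ^ 2) (by
          rintro ⟨h1, h2, h3⟩
          have h2' := (mul_eq_zero.1 h2).resolve_right hT0
          have h3' := (mul_eq_zero.1 h3).resolve_right (pow_ne_zero 2 hT0)
          have hsq : ρ (x ^ 2) = 1 := by
            rw [map_pow]
            exact sq_eq_one_of_scalar g h1 (by omega) (by omega)
          have := hρ (hsq.trans (map_one ρ).symm)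
          exact hx1 ((pow_eq_one_iff_left two_ne_zero).1 this))
      filter_upwards [hne] with j hj
      have : (![-(ξ j 1 : ℝ), (ξ j 0 : ℝ)] ⬝ᵥ
          (Φ 0 0 (FreeGroup.map some x) *ᵥ fun i => (ξ j i : ℝ))) =
          ((g 1 0 + ((2 * g 1 0 - g 0 0 + g 1 1) * T) * j +
            ((g 1 0 + g 1 1 - g 0 0 - g 0 1) * T ^ 2) * (j : ℤ) ^ 2 : ℤ) : ℝ) := by
        simp only [Φ, MonoidHom.comp_apply, hr, ← hg, dotProduct, mulVec, Fin.sum_univ_two,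
          realMatrix_apply, ξ, Matrix.cons_val_zero, Matrix.cons_val_one]
        push_cast
        ring
      rw [this]
      exact_mod_cast hj
  intro S hS
  have hall : ∀ᶠ j in atTop, ∀ᶠ k in atTop, ∀ s ∈ S, r j k s ≠ 1 := by
    have h1 := (Filter.eventually_all_finset S).2 fun s hs => key s (hS s hs)
    filter_upwards [h1] with j hj
    exact (Filter.eventually_all_finset S).2 hj
  obtain ⟨j, hj⟩ := hall.exists
  obtain ⟨k, hk⟩ := hj.exists
  exact ⟨r j k, hr j k, hk⟩

end FreeFactor

section FreeFactor

theorem isDiscriminated_map_of_card (n : ℕ) {κ : Type*} {ι : Type*} [Finite κ] [Nontrivial κ]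
    [Finite ι] (f : κ → ι) (hf : Function.Injective f) (h : Nat.card ι = Nat.card κ + n) :
    IsDiscriminated (FreeGroup.map f) := by
  induction n generalizing κ with
  | zero =>
    have hb : Function.Bijective f :=
      (Nat.bijective_iff_injective_and_card f).2 ⟨hf, by omega⟩
    have e := IsDiscriminated.of_mulEquiv (FreeGroup.freeGroupCongr (Equiv.ofBijective f hb))
    convert e using 1
    ext i
    simp
  | succ n ih =>
    obtain ⟨x, hx⟩ : ∃ x, x ∉ Set.range f := by
      by_contra hcon
      push Not at hcon
      have := Nat.card_eq_of_bijective f ⟨hf, hcon⟩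
      omega
    have hg : Function.Injective (fun o : Option κ => o.elim x f) := by
      rintro (_ | i) (_ | j) hij
      · rfl
      · exact absurd ⟨j, hij.symm⟩ hx
      · exact absurd ⟨i, hij⟩ hx
      · exact congrArg some (hf hij)
    have h2 := (isDiscriminated_map_some κ).trans
      (ih (κ := Option κ) _ hg (by rw [Finite.card_option]; omega))
    convert h2 using 1
    ext i
    simp

/-- The homomorphism killing all basis elements outside `E`. -/
noncomputable def restrictTo {ι : Type*} (E : Finset ι) : FreeGroup ι →* FreeGroup E :=
  open Classical in
  FreeGroup.lift fun i => if h : i ∈ E then FreeGroup.of ⟨i, h⟩ else 1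

theorem exists_finset_map_restrictTo {ι : Type*} (g : FreeGroup ι) :
    ∃ E : Finset ι, ∀ E' : Finset ι, E ⊆ E' → FreeGroup.map Subtype.val (restrictTo E' g) = g := by
  classical
  induction g using FreeGroup.induction_on with
  | C1 => exact ⟨∅, fun _ _ => by simp⟩
  | of i =>
    refine ⟨{i}, fun E' h => ?_⟩
    have hi : i ∈ E' := h (Finset.mem_singleton_self i)
    simp [restrictTo, hi]
  | inv_of i ih =>
    obtain ⟨E, hE⟩ := ih
    exact ⟨E, fun E' h => by rw [map_inv, map_inv, hE E' h]⟩
  | mul x y hx hy =>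
    obtain ⟨E, hE⟩ := hx
    obtain ⟨F, hF⟩ := hy
    exact ⟨E ∪ F, fun E' h => by
      rw [map_mul, map_mul, hE E' (Finset.union_subset_left h),
        hF E' (Finset.union_subset_right h)]⟩

/-- A free factor of finite rank at least two of a free group of any rank is discriminated. -/
theorem isDiscriminated_map {κ ι : Type*} [Finite κ] [Nontrivial κ] (f : κ → ι)
    (hf : Function.Injective f) : IsDiscriminated (FreeGroup.map f) := by
  classical
  intro S hS
  have := Fintype.ofFinite κ
  choose E hE using fun g : FreeGroup ι => exists_finset_map_restrictTo g
  let F : Finset ι := Finset.univ.image f ∪ S.biUnion E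
  have hF : ∀ i, f i ∈ F := fun i =>
    Finset.mem_union_left _ (Finset.mem_image_of_mem f (Finset.mem_univ i))
  let f' : κ → F := fun i => ⟨f i, hF i⟩
  have hf' : Function.Injective f' := fun i j h => hf (congrArg Subtype.val h)
  have hcard : Nat.card κ ≤ Nat.card F := Nat.card_le_card_of_injective f' hf'
  obtain ⟨r, hr, hr'⟩ := isDiscriminated_map_of_card (Nat.card F - Nat.card κ) f' hf' (by omega)
    (S.image (restrictTo F)) (by
      intro s hs h1
      obtain ⟨t, ht, rfl⟩ := Finset.mem_image.1 hs
      have := hE t F ((Finset.subset_biUnion_of_mem E ht).trans Finset.subset_union_right)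
      rw [h1, map_one] at this
      exact hS t ht this.symm)
  refine ⟨r.comp (restrictTo F), fun x => ?_, fun s hs => hr' _ (Finset.mem_image_of_mem _ hs)⟩
  have : (restrictTo F).comp (FreeGroup.map f) = FreeGroup.map f' := by
    ext i
    simp [restrictTo, hF i, f']
  rw [MonoidHom.comp_apply, ← MonoidHom.comp_apply, ← MonoidHom.comp_apply, MonoidHom.comp_assoc,
    this]
  exact hr x

end FreeFactor

/-! ### Conjugation by powers of a hyperbolic element -/

section BigPowers

open Filter Topology Matrix

/-- `u` is diagonalized over the reals by `S` (with inverse `S'`), with eigenvalues `μ > 1` and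
`μ⁻¹`. -/
structure IsHyperbolic (u : Matrix.SpecialLinearGroup (Fin 2) ℤ) (μ : ℝ)
    (S S' : Matrix (Fin 2) (Fin 2) ℝ) : Prop where
  one_lt : 1 < μ
  mul_eq_one : S * S' = 1
  eq_conj : realMatrix u = S * diagonal ![μ, μ⁻¹] * S'

theorem exists_isHyperbolic (u : Matrix.SpecialLinearGroup (Fin 2) ℤ) (h10 : u 1 0 ≠ 0)
    (htr : 2 < u 0 0 + u 1 1) : ∃ μ S S', IsHyperbolic u μ S S' := by
  set a : ℝ := ((u 0 0 : ℤ) : ℝ) with ha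
  set b : ℝ := ((u 0 1 : ℤ) : ℝ) with hb
  set c : ℝ := ((u 1 0 : ℤ) : ℝ) with hc
  set d : ℝ := ((u 1 1 : ℤ) : ℝ) with hd
  have hdet : a * d - b * c = 1 := by
    have := Matrix.det_fin_two u.1
    rw [u.2] at this
    rw [ha, hb, hc, hd]
    exact_mod_cast this.symm
  have hc0 : c ≠ 0 := by rw [hc]; exact_mod_cast h10
  have ht : 2 < a + d := by rw [ha, hd]; exact_mod_cast htr
  set μ : ℝ := ((a + d) + √((a + d) ^ 2 - 4)) / 2 with hμ
  have hsq : √((a + d) ^ 2 - 4) ^ 2 = (a + d) ^ 2 - 4 := Real.sq_sqrt (by nlinarith)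
  have hμ1 : 1 < μ := by
    have := Real.sqrt_nonneg ((a + d) ^ 2 - 4)
    rw [hμ]; linarith
  have hμ0 : μ ≠ 0 := by positivity
  have hchar : μ ^ 2 - (a + d) * μ + 1 = 0 := by rw [hμ]; linear_combination hsq / 4
  have hinv : μ⁻¹ = a + d - μ := by
    field_simp
    linear_combination hchar
  have hD : μ - μ⁻¹ ≠ 0 := by
    have : μ⁻¹ < 1 := inv_lt_one_of_one_lt₀ hμ1
    exact (sub_pos.2 (this.trans hμ1)).ne'
  -- the columns of `S` are the eigenvectors `(μ - d, c)` and `(μ⁻¹ - d, c)`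
  refine ⟨μ, !![μ - d, μ⁻¹ - d; c, c],
    (c * (μ - μ⁻¹))⁻¹ • !![c, -(μ⁻¹ - d); -c, μ - d], hμ1, ?_, ?_⟩
  · rw [Matrix.mul_smul, Matrix.mul_fin_two, inv_smul_eq_iff₀ (mul_ne_zero hc0 hD)]
    ext i j
    fin_cases i <;> fin_cases j <;> simp <;> ring
  · rw [Matrix.mul_smul, eq_comm, inv_smul_eq_iff₀ (mul_ne_zero hc0 hD)]
    ext i j
    rw [hinv]
    fin_cases i <;> fin_cases j <;>
      simp [Matrix.mul_apply, Fin.sum_univ_two, vecMul_diagonal, realMatrix_apply, ← ha, ← hb,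
        ← hc, ← hd]
    · ring
    · linear_combination (2 * μ - a - d) * (hchar + hdet)
    · ring
    · ring

namespace IsHyperbolic

variable {u : Matrix.SpecialLinearGroup (Fin 2) ℤ} {μ : ℝ} {S S' : Matrix (Fin 2) (Fin 2) ℝ}

theorem pos (h : IsHyperbolic u μ S S') : 0 < μ := zero_lt_one.trans h.one_lt

theorem mul_eq_one' (h : IsHyperbolic u μ S S') : S' * S = 1 :=
  mul_eq_one_comm.1 h.mul_eq_one

theorem pow_eq (h : IsHyperbolic u μ S S') (k : ℕ) :
    realMatrix (u ^ k) = S * diagonal ![μ ^ k, (μ ^ k)⁻¹] * S' := by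
  induction k with
  | zero =>
    have : diagonal ![(1 : ℝ), 1] = (1 : Matrix (Fin 2) (Fin 2) ℝ) := by
      ext i j
      fin_cases i <;> fin_cases j <;> simp
    simp [this, h.mul_eq_one]
  | succ k ih =>
    rw [pow_succ, map_mul, ih, h.eq_conj]
    calc S * diagonal ![μ ^ k, (μ ^ k)⁻¹] * S' * (S * diagonal ![μ, μ⁻¹] * S')
        = S * diagonal ![μ ^ k, (μ ^ k)⁻¹] * (S' * S) * diagonal ![μ, μ⁻¹] * S' := by
          simp only [mul_assoc]
      _ = S * (diagonal ![μ ^ k, (μ ^ k)⁻¹] * diagonal ![μ, μ⁻¹]) * S' := by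
          rw [h.mul_eq_one', mul_one, mul_assoc S]
      _ = _ := by
          rw [diagonal_mul_diagonal]
          congr 3
          ext i
          fin_cases i
          · simp [pow_succ]
          · simp [pow_succ, mul_comm]

theorem inv_pow_eq (h : IsHyperbolic u μ S S') (k : ℕ) :
    realMatrix (u ^ k)⁻¹ = S * diagonal ![(μ ^ k)⁻¹, μ ^ k] * S' := by
  have hk : μ ^ k ≠ 0 := pow_ne_zero k h.pos.ne'
  have h1 : realMatrix (u ^ k)⁻¹ * realMatrix (u ^ k) = 1 := by
    rw [← map_mul, inv_mul_cancel, map_one]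
  have h2 : realMatrix (u ^ k) * (S * diagonal ![(μ ^ k)⁻¹, μ ^ k] * S') = 1 := by
    rw [h.pow_eq]
    calc S * diagonal ![μ ^ k, (μ ^ k)⁻¹] * S' * (S * diagonal ![(μ ^ k)⁻¹, μ ^ k] * S')
        = S * diagonal ![μ ^ k, (μ ^ k)⁻¹] * (S' * S) * diagonal ![(μ ^ k)⁻¹, μ ^ k] * S' := by
          simp only [mul_assoc]
      _ = S * (diagonal ![μ ^ k, (μ ^ k)⁻¹] * diagonal ![(μ ^ k)⁻¹, μ ^ k]) * S' := by
          rw [h.mul_eq_one', mul_one, mul_assoc S]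
      _ = S * 1 * S' := by
          rw [diagonal_mul_diagonal]
          congr 2
          ext i j
          fin_cases i <;> fin_cases j <;> simp [hk]
      _ = 1 := by rw [mul_one, h.mul_eq_one]
  exact left_inv_eq_right_inv h1 h2

/-- Conjugation by `uᵏ` in eigencoordinates. -/
theorem conj_pow_eq (h : IsHyperbolic u μ S S') (p : Matrix.SpecialLinearGroup (Fin 2) ℤ)
    (k : ℕ) :
    realMatrix ((u ^ k)⁻¹ * p * u ^ k) =
      S * !![(S' * realMatrix p * S) 0 0, ((μ ^ k) ^ 2)⁻¹ * (S' * realMatrix p * S) 0 1;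
        (μ ^ k) ^ 2 * (S' * realMatrix p * S) 1 0, (S' * realMatrix p * S) 1 1] * S' := by
  have hk : μ ^ k ≠ 0 := pow_ne_zero k h.pos.ne'
  rw [map_mul, map_mul, h.pow_eq, h.inv_pow_eq]
  have e : S * diagonal ![(μ ^ k)⁻¹, μ ^ k] * S' * realMatrix p *
      (S * diagonal ![μ ^ k, (μ ^ k)⁻¹] * S') =
      S * (diagonal ![(μ ^ k)⁻¹, μ ^ k] * (S' * realMatrix p * S) *
        diagonal ![μ ^ k, (μ ^ k)⁻¹]) * S' := by simp only [mul_assoc]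
  rw [e]
  congr 2
  ext i j
  rw [mul_diagonal, diagonal_mul]
  fin_cases i <;> fin_cases j <;> simp <;> field_simp

theorem conj_inv_pow_eq (h : IsHyperbolic u μ S S') (p : Matrix.SpecialLinearGroup (Fin 2) ℤ)
    (k : ℕ) :
    realMatrix (u ^ k * p * (u ^ k)⁻¹) =
      S * !![(S' * realMatrix p * S) 0 0, (μ ^ k) ^ 2 * (S' * realMatrix p * S) 0 1;
        ((μ ^ k) ^ 2)⁻¹ * (S' * realMatrix p * S) 1 0, (S' * realMatrix p * S) 1 1] * S' := by
  have hk : μ ^ k ≠ 0 := pow_ne_zero k h.pos.ne'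
  rw [map_mul, map_mul, h.pow_eq, h.inv_pow_eq]
  have e : S * diagonal ![μ ^ k, (μ ^ k)⁻¹] * S' * realMatrix p *
      (S * diagonal ![(μ ^ k)⁻¹, μ ^ k] * S') =
      S * (diagonal ![μ ^ k, (μ ^ k)⁻¹] * (S' * realMatrix p * S) *
        diagonal ![(μ ^ k)⁻¹, μ ^ k]) * S' := by simp only [mul_assoc]
  rw [e]
  congr 2
  ext i j
  rw [mul_diagonal, diagonal_mul]
  fin_cases i <;> fin_cases j <;> simp <;> field_simp

theorem tendsto_sq (h : IsHyperbolic u μ S S') :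
    Tendsto (fun k : ℕ => (μ ^ k) ^ 2) atTop atTop :=
  (tendsto_pow_atTop two_ne_zero).comp (tendsto_pow_atTop_atTop_of_one_lt h.one_lt)

end IsHyperbolic

/-- The discreteness of `SL₂(ℤ)`: a convergent sequence of conjugates `u⁻ᵏ p uᵏ` is eventually
constant, so that `p` commutes with `u`. -/
theorem commute_of_tendsto_conj {u p : Matrix.SpecialLinearGroup (Fin 2) ℤ}
    {X : Matrix (Fin 2) (Fin 2) ℝ}
    (h : Tendsto (fun k : ℕ => realMatrix ((u ^ k)⁻¹ * p * u ^ k)) atTop (𝓝 X)) :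
    Commute p u := by
  have h1 := (h.comp (tendsto_add_atTop_nat 1)).sub h
  rw [sub_self] at h1
  have h2 : ∀ i j, ∀ᶠ k : ℕ in atTop,
      ((u ^ (k + 1))⁻¹ * p * u ^ (k + 1)) i j = ((u ^ k)⁻¹ * p * u ^ k) i j := by
    intro i j
    have h3 := tendsto_pi_nhds.1 (tendsto_pi_nhds.1 h1 i) j
    filter_upwards [h3.eventually (Metric.ball_mem_nhds _ one_pos)] with k hk
    change dist (realMatrix ((u ^ (k + 1))⁻¹ * p * u ^ (k + 1)) i j -
      realMatrix ((u ^ k)⁻¹ * p * u ^ k) i j) 0 < 1 at hk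
    rw [Real.dist_eq, sub_zero, realMatrix_apply, realMatrix_apply, ← Int.cast_sub,
      ← Int.cast_abs] at hk
    have hk' : |((u ^ (k + 1))⁻¹ * p * u ^ (k + 1)) i j - ((u ^ k)⁻¹ * p * u ^ k) i j| < 1 := by
      exact_mod_cast hk
    exact sub_eq_zero.1 (Int.abs_lt_one_iff.1 hk')
  have h4 := (eventually_all.2 fun i => eventually_all.2 (h2 i)).exists
  obtain ⟨k, hk⟩ := h4
  have h5 : (u ^ (k + 1))⁻¹ * p * u ^ (k + 1) = (u ^ k)⁻¹ * p * u ^ k := by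
    ext i j
    exact hk i j
  have h6 : u⁻¹ * p * u = p := by
    calc u⁻¹ * p * u = u ^ k * ((u ^ (k + 1))⁻¹ * p * u ^ (k + 1)) * (u ^ k)⁻¹ := by
          rw [pow_succ']; group
      _ = p := by rw [h5]; group
  calc p * u = u * (u⁻¹ * p * u) := by group
    _ = u * p := by rw [h6]

theorem IsHyperbolic.commute_of_apply_one_zero {u : Matrix.SpecialLinearGroup (Fin 2) ℤ} {μ : ℝ}
    {S S' : Matrix (Fin 2) (Fin 2) ℝ} (h : IsHyperbolic u μ S S')
    {p : Matrix.SpecialLinearGroup (Fin 2) ℤ} (hp : (S' * realMatrix p * S) 1 0 = 0) :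
    Commute p u := by
  refine commute_of_tendsto_conj (X := S * !![(S' * realMatrix p * S) 0 0, 0 *
    (S' * realMatrix p * S) 0 1; 0, (S' * realMatrix p * S) 1 1] * S') ?_
  simp_rw [h.conj_pow_eq, hp, mul_zero]
  refine (tendsto_const_nhds.mul ?_).mul_const _
  refine tendsto_pi_nhds.2 fun i => tendsto_pi_nhds.2 fun j => ?_
  have h0 := h.tendsto_sq.inv_tendsto_atTop.mul_const ((S' * realMatrix p * S) 0 1)
  fin_cases i <;> fin_cases j
  · exact tendsto_const_nhds
  · exact h0
  · exact tendsto_const_nhds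
  · exact tendsto_const_nhds

theorem IsHyperbolic.commute_of_apply_zero_one {u : Matrix.SpecialLinearGroup (Fin 2) ℤ} {μ : ℝ}
    {S S' : Matrix (Fin 2) (Fin 2) ℝ} (h : IsHyperbolic u μ S S')
    {p : Matrix.SpecialLinearGroup (Fin 2) ℤ} (hp : (S' * realMatrix p * S) 0 1 = 0) :
    Commute p u := by
  rw [← Commute.inv_right_iff]
  refine commute_of_tendsto_conj (X := S * !![(S' * realMatrix p * S) 0 0, 0; 0 *
    (S' * realMatrix p * S) 1 0, (S' * realMatrix p * S) 1 1] * S') ?_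
  simp_rw [inv_pow, inv_inv, h.conj_inv_pow_eq, hp, mul_zero]
  refine (tendsto_const_nhds.mul ?_).mul_const _
  refine tendsto_pi_nhds.2 fun i => tendsto_pi_nhds.2 fun j => ?_
  have h0 := h.tendsto_sq.inv_tendsto_atTop.mul_const ((S' * realMatrix p * S) 1 0)
  fin_cases i <;> fin_cases j
  · exact tendsto_const_nhds
  · exact tendsto_const_nhds
  · exact h0
  · exact tendsto_const_nhds

/-- Let `G` be generated by `P` and `Q`, and let the homomorphisms `φ k` agree on `P` and differ
on `Q` by conjugation by `uᵏ`. If only the elements of `C ≤ P ⊓ Q` are mapped into the centralizer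
of `u`, then every nontrivial element of `G` has nontrivial image under `φ k` for large `k`. -/
theorem eventually_ne_one_of_conj_pow {G F : Type*} [Group G] [Group F]
    {ρ : F →* Matrix.SpecialLinearGroup (Fin 2) ℤ} (hρ : Function.Injective ρ) {u : F} {μ : ℝ}
    {S S' : Matrix (Fin 2) (Fin 2) ℝ} (hu : IsHyperbolic (ρ u) μ S S')
    {P Q C : Subgroup G} (hPQ : P ⊔ Q = ⊤) (hCP : C ≤ P) (hCQ : C ≤ Q) (φ : ℕ → G →* F)
    (hφP : ∀ p ∈ P, ∀ k, φ k p = φ 0 p)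
    (hφQ : ∀ q ∈ Q, ∀ k, φ k q = (u ^ k)⁻¹ * φ 0 q * u ^ k)
    (hinj : ∀ p ∈ P, φ 0 p = 1 → p = 1)
    (hP : ∀ p ∈ P, Commute (φ 0 p) u → p ∈ C) (hQ : ∀ q ∈ Q, Commute (φ 0 q) u → q ∈ C)
    {g : G} (hg : g ≠ 1) : ∀ᶠ k in atTop, φ k g ≠ 1 := by
  have hcomm : ∀ x : F, Commute (ρ x) (ρ u) → Commute x u := fun x hx =>
    hρ (by rw [map_mul, map_mul]; exact hx)
  rcases mem_or_exists_isAlternating hPQ hCP hCQ g with hgP | ⟨p, hp, w, hw, rfl⟩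
  · refine Eventually.of_forall fun k h1 => hg (hinj g hgP ?_)
    rw [← hφP g hgP k, h1]
  let Φ : Unit → ℕ → G →* Matrix (Fin 2) (Fin 2) ℝ := fun _ k => realMatrix.comp (ρ.comp (φ k))
  have := hw.eventually_ne_one (l := (⊤ : Filter Unit)) (Φ := Φ) (π := Φ () 0)
    (c := fun k => (μ ^ k) ^ 2) (ξ := fun _ => S.col 1) (η := fun _ => S'.row 0)
    hu.tendsto_sq ?_ ?_ ?_ ?_ ?_ hp
  · filter_upwards [(eventually_top.1 this) ()] with k hk h1
    exact hk (by simp only [Φ, MonoidHom.comp_apply, h1, map_one])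
  · intro _ h0
    have h1 := congrFun (congrFun hu.mul_eq_one' 1) 1
    rw [Matrix.mul_apply, Fin.sum_univ_two] at h1
    have e0 : S 0 1 = 0 := congrFun h0 0
    have e1 : S 1 1 = 0 := congrFun h0 1
    simp [e0, e1] at h1
  · intro _ h0
    have h1 := congrFun (congrFun hu.mul_eq_one' 0) 0
    rw [Matrix.mul_apply, Fin.sum_univ_two] at h1
    have e0 : S' 0 0 = 0 := congrFun h0 0
    have e1 : S' 0 1 = 0 := congrFun h0 1
    simp [e0, e1] at h1
  · intro p hp _ k
    simp only [Φ, MonoidHom.comp_apply, hφP p hp k]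
  · intro q hq hqC _
    -- in eigencoordinates `u⁻ᵏ q uᵏ` is dominated by its lower left entry, of size `μ²ᵏ`
    set X := S' * realMatrix (ρ (φ 0 q)) * S with hX
    refine ⟨X 1 0, fun h0 => hqC (hQ q hq (hcomm _ (hu.commute_of_apply_one_zero h0))), ?_⟩
    have hlim : Tendsto (fun k : ℕ => S * !![((μ ^ k) ^ 2)⁻¹ * X 0 0,
        ((μ ^ k) ^ 2)⁻¹ * (((μ ^ k) ^ 2)⁻¹ * X 0 1); X 1 0, ((μ ^ k) ^ 2)⁻¹ * X 1 1] * S') atTop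
        (𝓝 (S * !![0 * X 0 0, 0 * (0 * X 0 1); X 1 0, 0 * X 1 1] * S')) := by
      have h0 := hu.tendsto_sq.inv_tendsto_atTop
      refine (tendsto_const_nhds.mul ?_).mul_const _
      refine tendsto_pi_nhds.2 fun i => tendsto_pi_nhds.2 fun j => ?_
      fin_cases i <;> fin_cases j
      · exact h0.mul_const _
      · exact h0.mul (h0.mul_const _)
      · exact tendsto_const_nhds
      · exact h0.mul_const _
    have e : S * !![0 * X 0 0, 0 * (0 * X 0 1); X 1 0, 0 * X 1 1] * S' =
        X 1 0 • vecMulVec (S.col 1) (S'.row 0) := by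
      ext i j
      simp only [Matrix.mul_apply, Fin.sum_univ_two]
      simp [vecMulVec_apply]
      ring
    rw [← e]
    refine hlim.congr fun k => ?_
    have hk : (μ ^ k) ^ 2 ≠ 0 := pow_ne_zero 2 (pow_ne_zero k hu.pos.ne')
    simp only [Φ, MonoidHom.comp_apply, hφQ q hq k, map_mul ρ, map_inv ρ, map_pow ρ]
    rw [hu.conj_pow_eq, ← hX, ← Matrix.smul_mul, ← Matrix.mul_smul]
    congr 2
    ext i j
    fin_cases i <;> fin_cases j <;> simp
    rw [inv_mul_cancel_left₀]
    simpa using hk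
  · intro p hp hpC
    refine eventually_top.2 fun _ h0 => hpC (hP p hp (hcomm _ (hu.commute_of_apply_zero_one ?_)))
    rw [← h0]
    simp only [Matrix.mul_apply, Fin.sum_univ_two, dotProduct, mulVec]
    simp [Φ]
    ring

end BigPowers

/-! ### The centralizer of `x² hᵐ` -/

section Centralizer

theorem subsingleton_of_commute_of {ι : Type*} (hc : ∀ i j : ι,
    Commute (FreeGroup.of i) (FreeGroup.of j)) : Subsingleton ι := by
  classical
  refine ⟨fun i j => ?_⟩
  by_contra hij
  have h := congrArg (FreeGroup.lift fun l => if l = i then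
    Equiv.swap (0 : Fin 3) 1 else Equiv.swap 1 2) (hc i j).eq
  simp only [map_mul, FreeGroup.lift_apply_of, if_true, if_neg (Ne.symm hij)] at h
  exact absurd h (by decide)

/-- Commuting elements of a free group are powers of a common element, because the subgroup they
generate is free and commutative. -/
theorem exists_zpow_eq_of_commute {α : Type*} {g u : FreeGroup α} (h : Commute g u) :
    ∃ (r : FreeGroup α) (i j : ℤ), r ^ i = g ∧ r ^ j = u := by
  let K : Subgroup (FreeGroup α) := Subgroup.closure {g, u}
  have hcomm : ∀ x y : K, x * y = y * x := by
    have : IsMulCommutative K := Subgroup.isMulCommutative_closure (by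
      rintro x (rfl | rfl) y (rfl | rfl)
      · rfl
      · exact h.eq
      · exact h.eq.symm
      · rfl)
    exact fun x y => mul_comm' x y
  let e := IsFreeGroup.toFreeGroup K
  have hsub : Subsingleton (IsFreeGroup.Generators K) := subsingleton_of_commute_of fun i j =>
    e.symm.injective (by rw [map_mul, map_mul, hcomm])
  have hcyc : ∃ r : K, ∀ x : K, ∃ i : ℤ, r ^ i = x := by
    rcases isEmpty_or_nonempty (IsFreeGroup.Generators K) with hE | ⟨⟨l⟩⟩
    · exact ⟨1, fun x => ⟨0, e.injective (Subsingleton.elim _ _)⟩⟩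
    · refine ⟨e.symm (FreeGroup.of l), fun x => ?_⟩
      have hx : e x ∈ Subgroup.closure (Set.range FreeGroup.of) := by
        rw [FreeGroup.closure_range_of]
        trivial
      have hr : Set.range (FreeGroup.of : IsFreeGroup.Generators K → _) = {FreeGroup.of l} := by
        ext y
        constructor
        · rintro ⟨l', rfl⟩
          rw [Subsingleton.elim l' l]
          rfl
        · rintro rfl
          exact ⟨l, rfl⟩
      rw [hr, Subgroup.mem_closure_singleton] at hx
      obtain ⟨i, hi⟩ := hx
      exact ⟨i, e.injective (by rw [map_zpow, MulEquiv.apply_symm_apply, hi])⟩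
  obtain ⟨r, hr⟩ := hcyc
  obtain ⟨i, hi⟩ := hr ⟨g, Subgroup.subset_closure (by simp)⟩
  obtain ⟨j, hj⟩ := hr ⟨u, Subgroup.subset_closure (by simp)⟩
  exact ⟨r, i, j, congrArg Subtype.val hi, congrArg Subtype.val hj⟩

/-- The element `x² hᵐ` of the free group on `a, h, x`, numbered in this order. -/
def uThree (m : ℕ) : FreeGroup (Fin 3) := FreeGroup.of 2 ^ 2 * FreeGroup.of 1 ^ m

/-- `x² hᵐ` is not a square: it can be sent to a matrix of trace less than `-2`, and the square of
an integer unimodular matrix has trace at least `-2`. -/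
theorem uThree_ne_sq {m : ℕ} (hm : 1 ≤ m) (r : FreeGroup (Fin 3)) : uThree m ≠ r ^ 2 := by
  intro h
  let f : FreeGroup (Fin 3) →* Matrix.SpecialLinearGroup (Fin 2) ℤ :=
    FreeGroup.lift ![1, transvection ![0, 1] 3, transvection ![1, 0] 1]
  have h1 : f (uThree m) = transvection ![1, 0] 2 * transvection ![0, 1] (m * 3) := by
    simp [f, uThree, transvection_pow]
  have h2 : f (uThree m) = f r * f r := by rw [h, map_pow, pow_two]
  set R := f r
  have hdet := Matrix.det_fin_two R.1
  rw [R.2] at hdet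
  have e0 := congrArg (fun g : Matrix.SpecialLinearGroup (Fin 2) ℤ => g 0 0 + g 1 1)
    (h1.symm.trans h2)
  simp only [Matrix.SpecialLinearGroup.coe_mul, Matrix.mul_apply, Fin.sum_univ_two] at e0
  simp [transvection] at e0
  have hm' : (1 : ℤ) ≤ m := by exact_mod_cast hm
  have hsq : 0 ≤ (R 0 0 + R 1 1) ^ 2 := sq_nonneg _
  have : (R 0 0 + R 1 1) ^ 2 = 4 - 6 * (m : ℤ) := by
    linear_combination -e0 - 2 * hdet
  linarith

/-- The centralizer of `x² hᵐ` is generated by this element: the exponent sum of `x` allows only a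
square root besides the trivial roots. -/
theorem mem_zpowers_uThree {m : ℕ} (hm : 1 ≤ m) {g : FreeGroup (Fin 3)}
    (h : Commute g (uThree m)) : ∃ i : ℤ, uThree m ^ i = g := by
  obtain ⟨r, i, j, hi, hj⟩ := exists_zpow_eq_of_commute h
  let f : FreeGroup (Fin 3) →* Multiplicative ℤ :=
    FreeGroup.lift ![1, 1, Multiplicative.ofAdd 1]
  have h2 : j * (f r).toAdd = 2 := by
    have h1 := congrArg (fun g => (f g).toAdd) hj
    simpa [f, uThree] using h1
  have hdvd : j ∣ 2 := ⟨_, h2.symm⟩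
  have hle := Int.le_of_dvd two_pos hdvd
  have hle' := Int.le_of_dvd two_pos (neg_dvd.2 hdvd)
  have hcases : j = 1 ∨ j = -1 ∨ j = 2 ∨ j = -2 := by
    have h0 : j ≠ 0 := by
      rintro rfl
      simp at h2
    omega
  rcases hcases with rfl | rfl | rfl | rfl
  · exact ⟨i, by rw [← hj, zpow_one, hi]⟩
  · exact ⟨-i, by rw [← hj, ← zpow_mul, neg_mul_neg, one_mul, hi]⟩
  · exact absurd hj.symm (uThree_ne_sq hm r)
  · refine absurd ?_ (uThree_ne_sq hm r⁻¹)
    rw [← hj]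
    group

end Centralizer

/-! ### The rank-four group and its rank-two subgroup -/

section RankFour

open Filter

/-- The word `y² (c y²ⁿ)ᵐ`, which equals `uᵗ = u` for `c = bᵗ` and `y = xᵗ`. -/
def wWord {G : Type*} [Group G] (n m : ℕ) (c y : G) : G := y ^ 2 * (c * y ^ (2 * n)) ^ m

/-- The word expressing `b = h x⁻²ⁿ` in terms of `h`, `c = bᵗ` and `y = xᵗ`, by means of
`x² = u h⁻ᵐ`. -/
def bWord {G : Type*} [Group G] (n m : ℕ) (h c y : G) : G := h * (h ^ m * (wWord n m c y)⁻¹) ^ n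

theorem map_wWord {G H : Type*} [Group G] [Group H] (f : G →* H) (n m : ℕ) (c y : G) :
    f (wWord n m c y) = wWord n m (f c) (f y) := by simp [wWord]

theorem map_bWord {G H : Type*} [Group G] [Group H] (f : G →* H) (n m : ℕ) (h c y : G) :
    f (bWord n m h c y) = bWord n m (f h) (f c) (f y) := by simp [bWord, map_wWord]

/-- The word `w` in the last two of the four free generators `a, h, c, y`. -/
def wFour (n m : ℕ) : FreeGroup (Fin 4) := wWord n m (FreeGroup.of 2) (FreeGroup.of 3)

/-- The element `b` of the free group on `a, h, c, y`. -/
def bFour (n m : ℕ) : FreeGroup (Fin 4) :=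
  bWord n m (FreeGroup.of 1) (FreeGroup.of 2) (FreeGroup.of 3)

/-- The homomorphism sending `a, h, c = bᵗ, y = xᵗ` to `a, h` and to the conjugates of `b = h x⁻²ⁿ`
and `x` by `uᵏ`. -/
def phi (n m k : ℕ) : FreeGroup (Fin 4) →* FreeGroup (Fin 3) :=
  FreeGroup.lift ![FreeGroup.of 0, FreeGroup.of 1,
    (uThree m ^ k)⁻¹ * (FreeGroup.of 1 * (FreeGroup.of 2 ^ (2 * n))⁻¹) * uThree m ^ k,
    (uThree m ^ k)⁻¹ * FreeGroup.of 2 * uThree m ^ k]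

theorem conj_hom {G : Type*} [Group G] (g x : G) : g⁻¹ * x * g = MulAut.conj g⁻¹ x := by
  simp

theorem phi_wFour (n m k : ℕ) : phi n m k (wFour n m) = uThree m := by
  have h : phi n m k (wFour n m) = MulAut.conj (uThree m ^ k)⁻¹ (uThree m) := by
    simp only [phi, wFour, wWord, map_mul, map_pow, FreeGroup.lift_apply_of, Matrix.cons_val,
      conj_hom]
    simp only [← map_mul, ← map_pow, inv_mul_cancel_right]
    rfl
  rw [h, ← conj_hom]
  group

theorem phi_bFour (n m k : ℕ) :
    phi n m k (bFour n m) = FreeGroup.of 1 * (FreeGroup.of 2 ^ (2 * n))⁻¹ := by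
  have hb : bFour n m = FreeGroup.of 1 * (FreeGroup.of 1 ^ m * (wFour n m)⁻¹) ^ n := rfl
  rw [hb, map_mul, map_pow, map_mul, map_inv, phi_wFour]
  simp only [phi, map_pow, FreeGroup.lift_apply_of, Matrix.cons_val, uThree, mul_inv_rev,
    mul_inv_cancel_left]
  rw [inv_pow, pow_mul]

/-- A faithful representation of the free group on `a, h, x`. Doubling `s` replaces `x` by `x²`, so
the restriction to `⟨a, h, x²⟩` shows that `a, h, x²` are free generators. -/
theorem lift_rhoThree_injective (s : ℤ) (hs : 3 < |s|) :
    Function.Injective (FreeGroup.lift fun i : Fin 3 =>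
      transvection ((![![1, 1], ![1, 0], ![0, 1] ] : Fin 3 → Fin 2 → ℤ) i)
        ((![4, 4, s] : Fin 3 → ℤ) i)) := by
  refine lift_transvection_injective _ _ 1 ?_ ?_ ?_
  · intro i j hij
    fin_cases i <;> fin_cases j <;> simp [wedge] at hij ⊢
  · intro i j
    fin_cases i <;> fin_cases j <;> simp [wedge]
  · intro i
    fin_cases i
    · simp
    · simp
    · simpa using hs

/-- The homomorphisms `phi n m k` separate `1` from each nontrivial element. The free group on
`a, h, c, y` is generated by `⟨a, h, w⟩` and `⟨c, y⟩`, which meet in `⟨w⟩`, and `phi n m k` maps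
them injectively to `⟨a, h, x²⟩` and to the conjugate of `⟨h, x⟩` by `uᵏ`. -/
theorem eventually_phi_ne_one {n m : ℕ} (hm : 1 ≤ m) {g : FreeGroup (Fin 4)} (hg : g ≠ 1) :
    ∀ᶠ k in atTop, phi n m k g ≠ 1 := by
  -- the sign of the last strength makes the trace `2 + 32 m` of the image of `u` positive
  let ρ := FreeGroup.lift fun i : Fin 3 =>
      transvection ((![![1, 1], ![1, 0], ![0, 1] ] : Fin 3 → Fin 2 → ℤ) i)
        ((![4, 4, -4] : Fin 3 → ℤ) i)
  have hρ : Function.Injective ρ := lift_rhoThree_injective (-4) (by norm_num)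
  have hρu : ρ (uThree m) = transvection ![0, 1] (-8) * transvection ![1, 0] (m * 4) := by
    simp [ρ, uThree, transvection_pow]
  obtain ⟨μ, S, S', hyp⟩ := exists_isHyperbolic (ρ (uThree m))
    (by
      rw [hρu, Matrix.SpecialLinearGroup.coe_mul, Matrix.mul_apply, Fin.sum_univ_two]
      simp [transvection])
    (by
      have : (1 : ℤ) ≤ m := by exact_mod_cast hm
      rw [hρu, Matrix.SpecialLinearGroup.coe_mul]
      simp only [Matrix.mul_apply, Fin.sum_univ_two]
      simp [transvection]
      linarith)
  -- `P = ⟨a, h, x²⟩`, with `x² = w h⁻ᵐ`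
  let θ : FreeGroup (Fin 3) →* FreeGroup (Fin 4) :=
    FreeGroup.lift ![FreeGroup.of 0, FreeGroup.of 1, wFour n m * (FreeGroup.of 1 ^ m)⁻¹]
  have hφ0 : ∀ k, phi n m k (FreeGroup.of 0) = FreeGroup.of 0 := fun k => by simp [phi]
  have hφ1 : ∀ k, phi n m k (FreeGroup.of 1) = FreeGroup.of 1 := fun k => by simp [phi]
  have hφθ : ∀ k, (phi n m k).comp θ =
      FreeGroup.lift ![FreeGroup.of 0, FreeGroup.of 1, FreeGroup.of 2 ^ 2] := by
    intro k
    ext i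
    fin_cases i
    · simp [θ, hφ0]
    · simp [θ, hφ1]
    · simp [θ, hφ1, phi_wFour, uThree]
  have hinjθ : Function.Injective ((phi n m 0).comp θ) := by
    have h8 := lift_rhoThree_injective (-8) (by norm_num)
    refine Function.Injective.of_comp (f := ρ) ?_
    rw [← MonoidHom.coe_comp]
    convert h8 using 2
    rw [hφθ]
    ext1 i
    fin_cases i
    · simp [ρ]
    · simp [ρ]
    · simp [ρ, transvection_pow]
  have hwP : wFour n m ∈ θ.range :=
    ⟨FreeGroup.of 2 * FreeGroup.of 1 ^ m, by simp [θ]⟩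
  let Q : Subgroup (FreeGroup (Fin 4)) := Subgroup.closure {FreeGroup.of 2, FreeGroup.of 3}
  have h2Q : FreeGroup.of 2 ∈ Q := Subgroup.subset_closure (by simp)
  have h3Q : FreeGroup.of 3 ∈ Q := Subgroup.subset_closure (by simp)
  have hwQ : wFour n m ∈ Q :=
    mul_mem (pow_mem h3Q _) (pow_mem (mul_mem h2Q (pow_mem h3Q _)) _)
  -- `χ` inverts `phi n m 0` on `Q = ⟨c, y⟩`
  let χ : FreeGroup (Fin 3) →* FreeGroup (Fin 4) :=
    FreeGroup.lift ![1, FreeGroup.of 2 * FreeGroup.of 3 ^ (2 * n), FreeGroup.of 3]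
  have hχ : ∀ q ∈ Q, χ (phi n m 0 q) = q := by
    intro q hq
    have : Set.EqOn (χ.comp (phi n m 0)) (MonoidHom.id _) Q := by
      refine MonoidHom.eqOn_closure ?_
      rintro _ (rfl | rfl)
      · simp [χ, phi]
      · simp [χ, phi]
    exact this hq
  refine eventually_ne_one_of_conj_pow hρ hyp (P := θ.range) (Q := Q)
    (C := Subgroup.zpowers (wFour n m)) ?_ ?_ ?_ (phi n m) ?_ ?_ ?_ ?_ ?_ hg
  · rw [eq_top_iff, ← FreeGroup.closure_range_of, Subgroup.closure_le]
    rintro _ ⟨i, rfl⟩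
    fin_cases i
    · exact Subgroup.mem_sup_left ⟨FreeGroup.of 0, by simp [θ]⟩
    · exact Subgroup.mem_sup_left ⟨FreeGroup.of 1, by simp [θ]⟩
    · exact Subgroup.mem_sup_right h2Q
    · exact Subgroup.mem_sup_right h3Q
  · exact Subgroup.zpowers_le.2 hwP
  · exact Subgroup.zpowers_le.2 hwQ
  · rintro _ ⟨f, rfl⟩ k
    exact (DFunLike.congr_fun (hφθ k) f).trans (DFunLike.congr_fun (hφθ 0) f).symm
  · intro q hq k
    have : Set.EqOn (phi n m k)
        ((MulAut.conj (uThree m ^ k)⁻¹).toMonoidHom.comp (phi n m 0)) Q := by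
      refine MonoidHom.eqOn_closure ?_
      rintro _ (rfl | rfl)
      · refine Eq.trans ?_ (conj_hom (uThree m ^ k) (phi n m 0 (FreeGroup.of 2)))
        simp [phi]
      · refine Eq.trans ?_ (conj_hom (uThree m ^ k) (phi n m 0 (FreeGroup.of 3)))
        simp [phi]
    rw [this hq, conj_hom]
    rfl
  · rintro _ ⟨f, rfl⟩ h1
    rw [hinjθ (a₁ := f) (a₂ := 1) (by rw [map_one]; exact h1), map_one]
  · rintro _ ⟨f, rfl⟩ hc
    obtain ⟨i, hi⟩ := mem_zpowers_uThree hm hc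
    obtain ⟨w', hw'⟩ := hwP
    refine ⟨i, ?_⟩
    have : w' ^ i = f := hinjθ (by
      rw [MonoidHom.comp_apply, MonoidHom.comp_apply, ← hi, map_zpow, map_zpow, hw', phi_wFour])
    change wFour n m ^ i = θ f
    rw [← this, map_zpow, hw']
  · intro q hq hc
    obtain ⟨i, hi⟩ := mem_zpowers_uThree hm hc
    refine ⟨i, ?_⟩
    change wFour n m ^ i = q
    rw [← hχ q hq, ← hi, ← phi_wFour n m 0, ← map_zpow, hχ _ (zpow_mem hwQ i)]

/-- The inclusion of the free group on `a, b` into the free group on `a, h, c, y`. -/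
def iotaTwo (n m : ℕ) : FreeGroup (Fin 2) →* FreeGroup (Fin 4) :=
  FreeGroup.lift ![FreeGroup.of 0, bFour n m]

/-- `⟨a, b⟩` is discriminated in `⟨a, h, x⟩`, where `b = h x⁻²ⁿ`. -/
theorem isDiscriminated_two_three (n : ℕ) : IsDiscriminated (FreeGroup.lift
    ![FreeGroup.of 0, FreeGroup.of 1 * (FreeGroup.of 2 ^ (2 * n))⁻¹] :
      FreeGroup (Fin 2) →* FreeGroup (Fin 3)) := by
  let f : FreeGroup (Fin 3) →* FreeGroup (Fin 3) :=
    FreeGroup.lift ![FreeGroup.of 0, FreeGroup.of 1 * (FreeGroup.of 2 ^ (2 * n))⁻¹, FreeGroup.of 2]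
  let f' : FreeGroup (Fin 3) →* FreeGroup (Fin 3) :=
    FreeGroup.lift ![FreeGroup.of 0, FreeGroup.of 1 * FreeGroup.of 2 ^ (2 * n), FreeGroup.of 2]
  let e : FreeGroup (Fin 3) ≃* FreeGroup (Fin 3) := f.toMulEquiv f'
    (by ext1 i; fin_cases i <;> simp [f, f']) (by ext1 i; fin_cases i <;> simp [f, f'])
  have h := (isDiscriminated_map (Fin.castSucc : Fin 2 → Fin 3)
    (Fin.castSucc_injective 2)).trans (IsDiscriminated.of_mulEquiv e)
  convert h using 1
  ext1 i
  fin_cases i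
  · simp [e, f]
  · simp [e, f]

/-- `⟨a, b⟩` is discriminated in the free group on `a, h, c, y`: compose `phi n m k` with
retractions of `⟨a, h, x⟩` onto `⟨a, b⟩`. -/
theorem isDiscriminated_iotaTwo {n m : ℕ} (hm : 1 ≤ m) : IsDiscriminated (iotaTwo n m) := by
  classical
  intro S hS
  obtain ⟨k, hk⟩ := ((eventually_all_finset S).2 fun s hs =>
    eventually_phi_ne_one (n := n) hm (hS s hs)).exists
  obtain ⟨r, hr, hr'⟩ := isDiscriminated_two_three n (S.image (phi n m k)) (by
    intro s hs
    obtain ⟨t, ht, rfl⟩ := Finset.mem_image.1 hs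
    exact hk t ht)
  refine ⟨r.comp (phi n m k), fun x => ?_, fun s hs => hr' _ (Finset.mem_image_of_mem _ hs)⟩
  have : (phi n m k).comp (iotaTwo n m) = FreeGroup.lift
      ![FreeGroup.of 0, FreeGroup.of 1 * (FreeGroup.of 2 ^ (2 * n))⁻¹] := by
    ext1 i
    fin_cases i
    · simp [iotaTwo, phi]
    · simp [iotaTwo, phi_bFour]
  exact (congrArg r (DFunLike.congr_fun this x)).trans (hr x)

end RankFour

/-! ### Affine actions and primitive elements -/

section Affine

/-- The action `ρ` of `G` on the complex line is affine, and its linear part is the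
character `χ`. -/
def HasLinearPart {G : Type*} [Group G] (χ : G →* ℂˣ) (ρ : G →* Equiv.Perm ℂ) : Prop :=
  ∀ g, ∃ c : ℂ, ∀ z, ρ g z = χ g * z + c

/-- The affine permutation `z ↦ l z + c`. -/
def affinePerm (l : ℂˣ) (c : ℂ) : Equiv.Perm ℂ where
  toFun z := l * z + c
  invFun z := (l⁻¹ : ℂˣ) * (z - c)
  left_inv z := by simp
  right_inv z := by simp

/-- An affine permutation whose linear part is a nontrivial `k`-th root of unity is a rotation
about its fixed point, so its `k`-th power is trivial. -/
theorem HasLinearPart.pow_eq_one {G : Type*} [Group G] {χ : G →* ℂˣ} {ρ : G →* Equiv.Perm ℂ}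
    (h : HasLinearPart χ ρ) {g : G} {k : ℕ} (h1 : χ g ≠ 1) (hk : χ g ^ k = 1) : ρ g ^ k = 1 := by
  obtain ⟨c, hc⟩ := h g
  have h1' : (1 : ℂ) - χ g ≠ 0 := sub_ne_zero.2 fun e => h1 (Units.ext e.symm)
  have key : ∀ (j : ℕ) (z : ℂ), (ρ g ^ j) z =
      (χ g : ℂ) ^ j * (z - c / (1 - χ g)) + c / (1 - χ g) := by
    intro j
    induction j with
    | zero => intro z; simp
    | succ j ih =>
      intro z
      rw [pow_succ, Equiv.Perm.mul_apply, ih, hc]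
      field_simp
      ring
  ext z
  have hk' : (χ g : ℂ) ^ k = 1 := by rw [← Units.val_pow_eq_pow_val, hk, Units.val_one]
  rw [key, hk']
  simp

/-- Affine actions of a free group with given linear part can be prescribed on a basis. -/
theorem exists_hasLinearPart_basis {ι G : Type*} [Group G] (B : FreeGroupBasis ι G)
    (χ : G →* ℂˣ) (i : ι) : ∃ ρ, HasLinearPart χ ρ ∧ ρ (B i) ≠ 1 := by
  let ρ : G →* Equiv.Perm ℂ := B.lift fun j => affinePerm (χ (B j)) 1
  have hρ : ∀ j, ρ (B j) = affinePerm (χ (B j)) 1 := fun j => by simp [ρ]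
  refine ⟨ρ, fun g => ?_, fun h => ?_⟩
  · obtain ⟨f, rfl⟩ := B.repr.symm.surjective g
    induction f using FreeGroup.induction_on with
    | C1 => exact ⟨0, fun z => by simp⟩
    | of j => exact ⟨1, fun z => by
        change ρ (B j) z = χ (B j) * z + 1
        rw [hρ]
        rfl⟩
    | inv_of j ih =>
      obtain ⟨c, hc⟩ := ih
      refine ⟨-((χ (B.repr.symm (FreeGroup.of j)))⁻¹ : ℂˣ) * c, fun z => ?_⟩
      rw [map_inv, map_inv, map_inv, Equiv.Perm.inv_eq_iff_eq, hc]
      simp [mul_add]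
    | mul x y hx hy =>
      obtain ⟨c, hc⟩ := hx
      obtain ⟨d, hd⟩ := hy
      refine ⟨χ (B.repr.symm x) * d + c, fun z => ?_⟩
      rw [map_mul, map_mul, map_mul, Equiv.Perm.mul_apply, hd, hc, Units.val_mul]
      ring
  · have := congrArg (fun σ : Equiv.Perm ℂ => σ 0) h
    simp [hρ, affinePerm] at this

/-- An element that dies in every affine action with a given linear part is not a member of a
basis. -/
theorem basis_ne_of_affine {ι G : Type*} [Group G] {b : G} {χ : G →* ℂˣ}
    (hb : ∀ ρ, HasLinearPart χ ρ → ρ b = 1) (B : FreeGroupBasis ι G) (i : ι) : B i ≠ b := by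
  rintro rfl
  obtain ⟨ρ, h1, h2⟩ := exists_hasLinearPart_basis B χ i
  exact h2 (hb ρ h1)

/-- A subgroup with a basis containing an element that dies in every affine action with a given
linear part is not a free factor: an affine action of the subgroup extends to the free product, the
complementary factor acting linearly. -/
theorem not_isFreeFactor_of_affine {ι G : Type*} [Group G] {H : Subgroup G} {χ : G →* ℂˣ}
    (B : FreeGroupBasis ι H) (i : ι)
    (hb : ∀ ρ, HasLinearPart χ ρ → ρ (B i) = 1) : ¬ IsFreeFactor H := by
  rintro ⟨K, hK⟩
  let e := MulEquiv.ofBijective _ hK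
  obtain ⟨ρH, h1, h2⟩ := exists_hasLinearPart_basis B (χ.comp H.subtype) i
  let ρK : K →* Equiv.Perm ℂ := (MulAction.toPermHom ℂˣ ℂ).comp (χ.comp K.subtype)
  let ρ : G →* Equiv.Perm ℂ := (Monoid.Coprod.lift ρH ρK).comp e.symm.toMonoidHom
  have hρ : ∀ f, ρ (e f) = Monoid.Coprod.lift ρH ρK f := fun f => by simp [ρ]
  have hinl : ∀ x : H, e (Monoid.Coprod.inl x) = x := fun x => by simp [e]
  have hinr : ∀ x : K, e (Monoid.Coprod.inr x) = x := fun x => by simp [e]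
  refine h2 ?_
  have h3 : ρ (B i) = ρH (B i) := by rw [← hinl, hρ, Monoid.Coprod.lift_apply_inl]
  rw [← h3]
  refine hb ρ fun g => ?_
  obtain ⟨f, rfl⟩ := e.surjective g
  induction f using Monoid.Coprod.induction_on with
  | inl x =>
    obtain ⟨c, hc⟩ := h1 x
    exact ⟨c, fun z => by rw [hρ, Monoid.Coprod.lift_apply_inl, hc, hinl]; rfl⟩
  | inr x =>
    refine ⟨0, fun z => ?_⟩
    rw [hρ, Monoid.Coprod.lift_apply_inr, hinr, add_zero]
    rfl
  | mul x y hx hy =>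
    obtain ⟨c, hc⟩ := hx
    obtain ⟨d, hd⟩ := hy
    refine ⟨χ (e x) * d + c, fun z => ?_⟩
    rw [map_mul, map_mul, map_mul, Equiv.Perm.mul_apply, hd, hc, Units.val_mul]
    ring

theorem exists_unit_pow_eq_one (k : ℕ) (hk : 2 ≤ k) : ∃ ζ : ℂˣ, ζ ≠ 1 ∧ ζ ^ k = 1 := by
  have h := Complex.isPrimitiveRoot_exp k (by omega)
  refine ⟨Units.mk0 (Complex.exp (2 * Real.pi * Complex.I / k)) (Complex.exp_ne_zero _),
    fun h1 => h.ne_one (by omega) ?_, Units.ext ?_⟩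
  · exact congrArg Units.val h1
  · simpa using h.pow_eq_one

/-- The word `b` dies in all affine actions in which `y`, `c` and `h` act with linear parts
nontrivial roots of unity of orders dividing `2`, `m` and `n m + 1`: then `y²` and `(c y²ⁿ)ᵐ` are
trivial, so `b` acts as `h ^ (n m + 1)`, which is trivial too. -/
theorem exists_character_bWord {ι G : Type*} [Group G] (B : FreeGroupBasis ι G) {n m : ℕ}
    (hn : 1 ≤ n) (hm : 2 ≤ m) {i j k : ι} (hij : i ≠ j) (hik : i ≠ k) (hjk : j ≠ k) :
    ∃ χ : G →* ℂˣ, ∀ ρ, HasLinearPart χ ρ → ρ (bWord n m (B i) (B j) (B k)) = 1 := by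
  classical
  -- `n ≥ 1` and `m ≥ 2` make both orders at least two, so that both roots can be chosen nontrivial
  obtain ⟨ζ, hζ, hζ'⟩ := exists_unit_pow_eq_one m hm
  obtain ⟨ω, hω, hω'⟩ := exists_unit_pow_eq_one (m * n + 1) (by nlinarith)
  let χ : G →* ℂˣ := B.lift fun l => if l = i then ω else if l = j then ζ else
    if l = k then -1 else 1
  have hi : χ (B i) = ω := by simp [χ]
  have hj : χ (B j) = ζ := by simp [χ, hij.symm]
  have hk : χ (B k) = -1 := by simp [χ, hik.symm, hjk.symm]
  refine ⟨χ, fun ρ hρ => ?_⟩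
  have hne : (-1 : ℂˣ) ≠ 1 := by
    intro h
    have := congrArg Units.val h
    norm_num at this
  have h1 : ρ (B k) ^ 2 = 1 := hρ.pow_eq_one (by rwa [hk]) (by simp [hk])
  have hcy : χ (B j * B k ^ (2 * n)) = ζ := by simp [hj, hk]
  have h2 : ρ (B j * B k ^ (2 * n)) ^ m = 1 :=
    hρ.pow_eq_one (by rwa [hcy]) (by rwa [hcy])
  have h3 : ρ (B i) ^ (m * n + 1) = 1 := hρ.pow_eq_one (by rwa [hi]) (by rwa [hi])
  rw [map_mul, map_pow] at h2
  simp only [bWord, wWord, map_mul, map_pow, map_inv]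
  rw [h1, h2, mul_one, inv_one, mul_one, ← pow_mul, ← pow_succ', h3]

end Affine

/-! ### Universal types in free groups -/

section Types

theorem comp_vec_one {α β : Type*} (f : α → β) (x : α) : f ∘ ![x] = ![f x] := by
  ext i
  fin_cases i
  rfl

theorem comp_vec_two {α β : Type*} (f : α → β) (x y : α) : f ∘ ![x, y] = ![f x, f y] := by
  ext i
  fin_cases i <;> rfl

/-- The element `b` of the free group on `h, c, y`, numbered in this order. -/
def bThree (n m : ℕ) : FreeGroup (Fin 3) :=
  bWord n m (FreeGroup.of 0) (FreeGroup.of 1) (FreeGroup.of 2)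

theorem isDiscriminated_map_succ : IsDiscriminated (FreeGroup.map (Fin.succ : Fin 3 → Fin 4)) :=
  isDiscriminated_map _ (Fin.succ_injective 3)

theorem map_succ_bThree (n m : ℕ) : FreeGroup.map Fin.succ (bThree n m) = bFour n m := by
  simp [bThree, bFour, map_bWord]

/-- Both `⟨a, b⟩` and `⟨a, h⟩` are discriminated in the free group on `a, h, c, y`, and free on the
given generators. -/
theorem forallType_pair_eq {n m : ℕ} (hm : 1 ≤ m) :
    forallType ![(FreeGroup.of 0 : FreeGroup (Fin 4)), bFour n m] =
      forallType ![(FreeGroup.of 0 : FreeGroup (Fin 4)), FreeGroup.of 1] := by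
  have h1 := (isDiscriminated_iotaTwo (n := n) hm).forallType_eq
    ![FreeGroup.of 0, FreeGroup.of 1]
  have h2 := (isDiscriminated_map (Fin.castLE (by omega) : Fin 2 → Fin 4)
    (Fin.castLE_injective _)).forallType_eq ![FreeGroup.of 0, FreeGroup.of 1]
  rw [comp_vec_two] at h1 h2
  simpa [iotaTwo] using h1.symm.trans h2

theorem forallType_bFour_eq {n m : ℕ} (hm : 1 ≤ m) :
    forallType ![bFour n m] = forallType ![(FreeGroup.of 1 : FreeGroup (Fin 4))] := by
  have h1 := (isDiscriminated_iotaTwo (n := n) hm).forallType_eq ![FreeGroup.of 1]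
  have h2 := (isDiscriminated_map (Fin.castLE (by omega) : Fin 2 → Fin 4)
    (Fin.castLE_injective _)).forallType_eq ![FreeGroup.of 1]
  rw [comp_vec_one] at h1 h2
  simpa [iotaTwo] using h1.symm.trans h2

theorem forallType_bThree_eq {n m : ℕ} (hm : 1 ≤ m) :
    forallType ![bThree n m] = forallType ![(FreeGroup.of 0 : FreeGroup (Fin 3))] := by
  have h1 := isDiscriminated_map_succ.forallType_eq ![bThree n m]
  have h2 := isDiscriminated_map_succ.forallType_eq ![FreeGroup.of 0]
  rw [comp_vec_one] at h1 h2
  rw [h1, h2, map_succ_bThree, forallType_bFour_eq hm]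
  simp

/-- Free groups of rank at least three are not `∀`-homogeneous: `b` and `h` have the same
`∀`-type, already in the free factor on `h, c, y`, but only `h` is primitive. -/
theorem not_isForallHomogeneous {ι G : Type*} [Group G] (B : FreeGroupBasis ι G)
    (e : Fin 3 ↪ ι) : ¬ IsForallHomogeneous G := by
  intro hG
  let f : FreeGroup (Fin 3) →* G := B.repr.symm.toMonoidHom.comp (FreeGroup.map e)
  have hf : IsDiscriminated f :=
    (isDiscriminated_map e e.injective).trans (IsDiscriminated.of_mulEquiv B.repr.symm)
  have hfi : ∀ i, f (FreeGroup.of i) = B (e i) := fun i => by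
    simp only [f, MonoidHom.comp_apply, FreeGroup.map.of]
    rfl
  have ht := forallType_bThree_eq (n := 1) (m := 2) one_le_two
  rw [hf.forallType_eq, hf.forallType_eq] at ht
  obtain ⟨σ, hσ⟩ := hG 1 _ _ ht
  have h0 : σ (f (bThree 1 2)) = B (e 0) := by
    rw [← hfi]
    exact hσ 0
  have hne : ∀ i j : Fin 3, i ≠ j → e i ≠ e j := fun i j => e.injective.ne
  obtain ⟨χ, hχ⟩ := exists_character_bWord B le_rfl le_rfl (hne 0 1 (by decide))
    (hne 0 2 (by decide)) (hne 1 2 (by decide))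
  refine basis_ne_of_affine hχ (B.map σ.symm) (e 0) ?_
  rw [FreeGroupBasis.map_apply, σ.symm_apply_eq.2 h0.symm, bThree, map_bWord, hfi, hfi, hfi]

end Types

/-! ### The subgroups of the one-relator group -/

section OneRelator

variable (n m : ℕ)

theorem commute_gT : Commute (gX n m ^ 2 * gH n m ^ m) (gT n m) := by
  have h : PresentedGroup.mk ({wordU n m * FreeGroup.of Letter.t * (wordU n m)⁻¹ *
      (FreeGroup.of Letter.t)⁻¹} : Set (FreeGroup Letter))
      (wordU n m * FreeGroup.of Letter.t * (wordU n m)⁻¹ * (FreeGroup.of Letter.t)⁻¹) = 1 :=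
    (QuotientGroup.eq_one_iff _).2 (Subgroup.subset_normalClosure rfl)
  rw [map_mul, map_inv, mul_inv_eq_one, map_mul, map_mul, map_inv, mul_inv_eq_iff_eq_mul] at h
  exact h

/-- The parametrization of `M` by the free group on `a, h, c, y`. -/
def theta : FreeGroup (Fin 4) →* LTwo n m :=
  FreeGroup.lift ![gA n m, gH n m, gBt n m, gXt n m]

/-- The homomorphism `L₂ → ⟨a, h, x⟩` that fixes `a, b, x` and sends `t` to `uᵏ`. -/
def psi (k : ℕ) : LTwo n m →* FreeGroup (Fin 3) :=
  PresentedGroup.toGroup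
    (f := fun l => match l with
      | Letter.a => FreeGroup.of 0
      | Letter.b => FreeGroup.of 1 * (FreeGroup.of 2 ^ (2 * n))⁻¹
      | Letter.x => FreeGroup.of 2
      | Letter.t => uThree m ^ k) (by
    rintro _ rfl
    simp only [wordU, map_mul, map_pow, map_inv, FreeGroup.lift_apply_of, inv_mul_cancel_right]
    change uThree m * uThree m ^ k * (uThree m)⁻¹ * (uThree m ^ k)⁻¹ = 1
    group)

theorem psi_theta (k : ℕ) (g : FreeGroup (Fin 4)) : psi n m k (theta n m g) = phi n m k g := by
  have hA : psi n m k (gA n m) = FreeGroup.of 0 := PresentedGroup.toGroup.of _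
  have hB : psi n m k (gB n m) = FreeGroup.of 1 * (FreeGroup.of 2 ^ (2 * n))⁻¹ :=
    PresentedGroup.toGroup.of _
  have hX : psi n m k (gX n m) = FreeGroup.of 2 := PresentedGroup.toGroup.of _
  have hT : psi n m k (gT n m) = uThree m ^ k := PresentedGroup.toGroup.of _
  have : (psi n m k).comp (theta n m) = phi n m k := by
    ext1 i
    fin_cases i
    · simp [theta, phi, hA]
    · simp [theta, phi, gH, hB, hX]
    · simp [theta, phi, gBt, hB, hT]
    · simp [theta, phi, gXt, hX, hT]
  exact DFunLike.congr_fun this g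

variable {m}

/-- `M` is free: a nontrivial element of the free group on `a, h, c, y` survives in a free quotient
of `L₂`. -/
theorem theta_injective (hm : 1 ≤ m) : Function.Injective (theta n m) := by
  refine (injective_iff_map_eq_one _).2 fun g hg => ?_
  by_contra hne
  obtain ⟨k, hk⟩ := (eventually_phi_ne_one (n := n) hm hne).exists
  exact hk (by rw [← psi_theta, hg, map_one])

variable (m)

/-- As `t` commutes with `u`, the word `w` in `bᵗ` and `xᵗ` equals `uᵗ = u = x² hᵐ`. -/
theorem wWord_gBt : wWord n m (gBt n m) (gXt n m) = gX n m ^ 2 * gH n m ^ m := by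
  have h1 : wWord n m (gBt n m) (gXt n m) =
      MulAut.conj (gT n m)⁻¹ (gX n m ^ 2 * gH n m ^ m) := by
    simp only [wWord, gBt, gXt, gH, conj_hom, map_mul, map_pow]
  rw [h1, ← conj_hom, mul_assoc, (commute_gT n m).eq, inv_mul_cancel_left]

theorem bWord_gH : bWord n m (gH n m) (gBt n m) (gXt n m) = gB n m := by
  rw [bWord, wWord_gBt, mul_inv_rev, mul_inv_cancel_left, inv_pow, ← pow_mul, gH,
    mul_inv_cancel_right]

theorem theta_bFour : theta n m (bFour n m) = gB n m := by
  rw [bFour, map_bWord]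
  simpa [theta] using bWord_gH n m

theorem range_theta : (theta n m).range = subM n m := by
  apply le_antisymm
  · have hA : gA n m ∈ subM n m := Subgroup.mem_sup_left (Subgroup.subset_closure (by simp))
    have hB : gB n m ∈ subM n m := Subgroup.mem_sup_left (Subgroup.subset_closure (by simp))
    have hX : gX n m ^ 2 ∈ subM n m := Subgroup.mem_sup_left (Subgroup.subset_closure (by simp))
    rw [MonoidHom.range_eq_map, ← FreeGroup.closure_range_of, MonoidHom.map_closure,
      Subgroup.closure_le]
    rintro _ ⟨_, ⟨i, rfl⟩, rfl⟩
    fin_cases i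
    · simpa [theta] using hA
    · have : gH n m ∈ subM n m := by
        rw [gH, pow_mul]
        exact mul_mem hB (pow_mem hX n)
      simpa [theta] using this
    · have : gBt n m ∈ subM n m := Subgroup.mem_sup_right (Subgroup.subset_closure (by simp))
      simpa [theta] using this
    · have : gXt n m ∈ subM n m := Subgroup.mem_sup_right (Subgroup.subset_closure (by simp))
      simpa [theta] using this
  · have hA : gA n m ∈ (theta n m).range := ⟨FreeGroup.of 0, by simp [theta]⟩
    have hH : gH n m ∈ (theta n m).range := ⟨FreeGroup.of 1, by simp [theta]⟩
    have hBt : gBt n m ∈ (theta n m).range := ⟨FreeGroup.of 2, by simp [theta]⟩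
    have hXt : gXt n m ∈ (theta n m).range := ⟨FreeGroup.of 3, by simp [theta]⟩
    refine sup_le ((Subgroup.closure_le _).2 ?_) ((Subgroup.closure_le _).2 ?_)
    · rintro _ (rfl | rfl | rfl)
      · exact hA
      · exact ⟨_, theta_bFour n m⟩
      · have : gX n m ^ 2 = wWord n m (gBt n m) (gXt n m) * (gH n m ^ m)⁻¹ := by
          rw [wWord_gBt, mul_inv_cancel_right]
        rw [this, wWord]
        exact mul_mem (mul_mem (pow_mem hXt _) (pow_mem (mul_mem hBt (pow_mem hXt _)) _))
          (inv_mem (pow_mem hH _))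
    · rintro _ (rfl | rfl)
      · exact hBt
      · exact hXt

theorem range_theta_iotaTwo : ((theta n m).comp (iotaTwo n m)).range = subL n m := by
  rw [MonoidHom.range_eq_map, ← FreeGroup.closure_range_of, MonoidHom.map_closure, ← Set.range_comp,
    subL]
  congr 1
  ext g
  simp only [Set.mem_range, Fin.exists_fin_two, Function.comp_apply, MonoidHom.comp_apply,
    iotaTwo, FreeGroup.lift_apply_of, Matrix.cons_val_zero, Matrix.cons_val_one, theta_bFour]
  simp [theta, eq_comm]

theorem range_theta_succ :
    ((theta n m).comp (FreeGroup.map (Fin.succ : Fin 3 → Fin 4))).range = subMThree n m := by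
  rw [MonoidHom.range_eq_map, ← FreeGroup.closure_range_of, MonoidHom.map_closure, ← Set.range_comp,
    subMThree]
  congr 1
  ext g
  simp [Fin.exists_fin_succ, theta, eq_comm]

end OneRelator

/-- An injective homomorphism, as an isomorphism onto its range. -/
noncomputable def equivOfRange {F G : Type*} [Group F] [Group G] (f : F →* G)
    (hf : Function.Injective f) {K : Subgroup G} (hK : f.range = K) : F ≃* K :=
  (MonoidHom.ofInjective hf).trans (MulEquiv.subgroupCongr hK)

theorem equivOfRange_apply {F G : Type*} [Group F] [Group G] (f : F →* G)
    (hf : Function.Injective f) {K : Subgroup G} (hK : f.range = K) (x : F) :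
    (equivOfRange f hf hK x : G) = f x := rfl

theorem ofRepr_symm_apply {ι G : Type*} [Group G] (e : FreeGroup ι ≃* G) (i : ι) :
    FreeGroupBasis.ofRepr e.symm i = e (FreeGroup.of i) := rfl

end FreeHom

/-- Free groups whose rank is finite and at least `3`, or countably infinite, are not
`∀`-homogeneous; and the explicit groups `L ≤ M` and `M₃` behave as claimed, for all exponents
`n ≥ 1` and `m ≥ 2`. -/
theorem mainTheorem1 :
    -- free groups of finite rank at least `3`, or of countably infinite rank
    (∀ (ι : Type*) (G : Type*) [Group G], FreeGroupBasis ι G →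
      3 ≤ Cardinal.mk ι → Cardinal.mk ι ≤ Cardinal.aleph0 → ¬ FreeHom.IsForallHomogeneous G) ∧
    -- the explicit example
    (∀ n m : ℕ, 1 ≤ n → 2 ≤ m →
      -- `L` is free on `a, b`
      (∃ B : FreeGroupBasis (Fin 2) (FreeHom.subL n m),
        ∀ i, (B i : FreeHom.LTwo n m) = ![FreeHom.gA n m, FreeHom.gB n m] i) ∧
      -- `M` is free of rank `4`, on `a, h, b ^ t, x ^ t` with `h = b x ^ (2 n)`
      (∃ B : FreeGroupBasis (Fin 4) (FreeHom.subM n m),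
        ∀ i, (B i : FreeHom.LTwo n m) =
          ![FreeHom.gA n m, FreeHom.gH n m, FreeHom.gBt n m, FreeHom.gXt n m] i) ∧
      -- `L` is an existentially closed subgroup of `M` that is not a free factor of `M`
      FreeHom.subL n m ≤ FreeHom.subM n m ∧
      FreeHom.IsExistentiallyClosed ((FreeHom.subL n m).subgroupOf (FreeHom.subM n m)) ∧
      ¬ FreeHom.IsFreeFactor ((FreeHom.subL n m).subgroupOf (FreeHom.subM n m)) ∧
      -- `(a, b)` and `(a, h)` have the same `∀`-type in `M`, but no automorphism of `M` carries
      -- the first to the second; `b` is not primitive in `M`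
      (∃ (ha : FreeHom.gA n m ∈ FreeHom.subM n m) (hb : FreeHom.gB n m ∈ FreeHom.subM n m)
          (hh : FreeHom.gH n m ∈ FreeHom.subM n m),
        FreeHom.forallType ![(⟨_, ha⟩ : FreeHom.subM n m), ⟨_, hb⟩] =
          FreeHom.forallType ![(⟨_, ha⟩ : FreeHom.subM n m), ⟨_, hh⟩] ∧
        ¬ FreeHom.IsPrimitive (⟨_, hb⟩ : FreeHom.subM n m) ∧
        ¬ ∃ σ : FreeHom.subM n m ≃* FreeHom.subM n m,
          σ ⟨_, ha⟩ = ⟨_, ha⟩ ∧ σ ⟨_, hb⟩ = ⟨_, hh⟩) ∧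
      -- `M₃` is free of rank `3`, on `h, b ^ t, x ^ t`
      (∃ B : FreeGroupBasis (Fin 3) (FreeHom.subMThree n m),
        ∀ i, (B i : FreeHom.LTwo n m) =
          ![FreeHom.gH n m, FreeHom.gBt n m, FreeHom.gXt n m] i) ∧
      -- `b` and `h` have the same `∀`-type in `M₃`; `h` is primitive in `M₃` and `b` is not, and
      -- no automorphism of `M₃` carries `b` to `h`
      (∃ (hb : FreeHom.gB n m ∈ FreeHom.subMThree n m)
          (hh : FreeHom.gH n m ∈ FreeHom.subMThree n m),
        FreeHom.forallType ![(⟨_, hb⟩ : FreeHom.subMThree n m)] =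
          FreeHom.forallType ![(⟨_, hh⟩ : FreeHom.subMThree n m)] ∧
        FreeHom.IsPrimitive (⟨_, hh⟩ : FreeHom.subMThree n m) ∧
        ¬ FreeHom.IsPrimitive (⟨_, hb⟩ : FreeHom.subMThree n m) ∧
        ¬ ∃ σ : FreeHom.subMThree n m ≃* FreeHom.subMThree n m, σ ⟨_, hb⟩ = ⟨_, hh⟩)) := by
  refine ⟨fun ι G _ B h3 _ => ?_, fun n m hn hm => ?_⟩
  · have h3' : Cardinal.lift.{_, 0} (Cardinal.mk (Fin 3)) ≤
        Cardinal.lift.{0, _} (Cardinal.mk ι) := by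
      simpa using h3
    exact FreeHom.not_isForallHomogeneous B (Cardinal.lift_mk_le'.1 h3').some
  open FreeHom in
  have hm1 : 1 ≤ m := by omega
  have hθ := theta_injective n hm1
  have hι := isDiscriminated_iotaTwo (n := n) hm1
  have hs := isDiscriminated_map_succ
  -- `E`, `EL` and `ET` parametrize `M`, `L` and `M₃` by free groups
  let E := equivOfRange (theta n m) hθ (range_theta n m)
  have hE : ∀ g, (E g : LTwo n m) = theta n m g := fun _ => rfl
  let EL := equivOfRange ((theta n m).comp (iotaTwo n m)) (hθ.comp hι.injective)
    (range_theta_iotaTwo n m)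
  let ET := equivOfRange ((theta n m).comp (FreeGroup.map (Fin.succ : Fin 3 → Fin 4)))
    (hθ.comp hs.injective) (range_theta_succ n m)
  have hET : ∀ g, (ET g : LTwo n m) = theta n m (FreeGroup.map Fin.succ g) := fun _ => rfl
  have hLM : subL n m ≤ subM n m := by
    rw [← range_theta_iotaTwo, ← range_theta]
    rintro _ ⟨g, rfl⟩
    exact ⟨_, rfl⟩
  have h0 : theta n m (FreeGroup.of 0) = gA n m := by simp [theta]
  have h1 : theta n m (FreeGroup.of 1) = gH n m := by simp [theta]
  have h2 : theta n m (FreeGroup.of 2) = gBt n m := by simp [theta]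
  have h3 : theta n m (FreeGroup.of 3) = gXt n m := by simp [theta]
  have hb := theta_bFour n m
  let j := E.toMonoidHom.comp (iotaTwo n m)
  have hj : IsDiscriminated j := hι.trans (IsDiscriminated.of_mulEquiv E)
  have hjr : j.range = (subL n m).subgroupOf (subM n m) := by
    ext x
    rw [Subgroup.mem_subgroupOf, ← range_theta_iotaTwo]
    constructor
    · rintro ⟨g, rfl⟩
      exact ⟨g, rfl⟩
    · rintro ⟨g, hg⟩
      exact ⟨g, Subtype.ext hg⟩
  have hAM : gA n m ∈ subM n m := h0 ▸ (E (FreeGroup.of 0)).2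
  have hBM : gB n m ∈ subM n m := hb ▸ (E (bFour n m)).2
  have hHM : gH n m ∈ subM n m := h1 ▸ (E (FreeGroup.of 1)).2
  have eA : (⟨_, hAM⟩ : subM n m) = E (FreeGroup.of 0) := Subtype.ext h0.symm
  have eB : (⟨_, hBM⟩ : subM n m) = E (bFour n m) := Subtype.ext hb.symm
  have eH : (⟨_, hHM⟩ : subM n m) = E (FreeGroup.of 1) := Subtype.ext h1.symm
  obtain ⟨χ, hχ⟩ := exists_character_bWord (FreeGroupBasis.ofRepr E.symm) hn hm
    (i := 1) (j := 2) (k := 3) (by decide) (by decide) (by decide)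
  simp only [ofRepr_symm_apply] at hχ
  have hbE : E (bFour n m) = bWord n m (E (FreeGroup.of 1)) (E (FreeGroup.of 2))
      (E (FreeGroup.of 3)) := map_bWord E.toMonoidHom n m _ _ _
  rw [← hbE] at hχ
  have hb3 : theta n m (FreeGroup.map Fin.succ (bThree n m)) = gB n m := by
    rw [map_succ_bThree, hb]
  have hBT : gB n m ∈ subMThree n m := hb3 ▸ (ET (bThree n m)).2
  have hh3 : theta n m (FreeGroup.map Fin.succ (FreeGroup.of 0)) = gH n m := by
    rw [FreeGroup.map.of]
    exact h1
  have hHT : gH n m ∈ subMThree n m := hh3 ▸ (ET (FreeGroup.of 0)).2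
  have eB' : (⟨_, hBT⟩ : subMThree n m) = ET (bThree n m) := Subtype.ext hb3.symm
  have eH' : (⟨_, hHT⟩ : subMThree n m) = ET (FreeGroup.of 0) := Subtype.ext hh3.symm
  obtain ⟨χ', hχ'⟩ := exists_character_bWord (FreeGroupBasis.ofRepr ET.symm) hn hm
    (i := 0) (j := 1) (k := 2) (by decide) (by decide) (by decide)
  simp only [ofRepr_symm_apply] at hχ'
  have hbET : ET (bThree n m) = bWord n m (ET (FreeGroup.of 0)) (ET (FreeGroup.of 1))
      (ET (FreeGroup.of 2)) := map_bWord ET.toMonoidHom n m _ _ _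
  rw [← hbET] at hχ'
  refine ⟨⟨FreeGroupBasis.ofRepr EL.symm, fun i => ?_⟩,
    ⟨FreeGroupBasis.ofRepr E.symm, fun i => ?_⟩, hLM, hj.isExistentiallyClosed _ hjr, ?_,
    ⟨hAM, hBM, hHM, ?_, ?_, ?_⟩, ⟨FreeGroupBasis.ofRepr ET.symm, fun i => ?_⟩,
    ⟨hBT, hHT, ?_, ?_, ?_, ?_⟩⟩
  · rw [ofRepr_symm_apply]
    change theta n m (iotaTwo n m (FreeGroup.of i)) = _
    fin_cases i
    · simpa [iotaTwo] using h0
    · simpa [iotaTwo] using hb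
  · rw [ofRepr_symm_apply, hE]
    simp [theta]
  · let J := equivOfRange j hj.injective hjr
    refine not_isFreeFactor_of_affine (FreeGroupBasis.ofRepr J.symm) 1 (χ := χ) fun ρ hρ => ?_
    have : (FreeGroupBasis.ofRepr J.symm 1 : subM n m) = E (bFour n m) := by
      rw [ofRepr_symm_apply, equivOfRange_apply]
      simp [j, iotaTwo]
    rw [this]
    exact hχ ρ hρ
  · have h := forallType_pair_eq (n := n) hm1
    rw [(IsDiscriminated.of_mulEquiv E).forallType_eq,
      (IsDiscriminated.of_mulEquiv E).forallType_eq, comp_vec_two, comp_vec_two] at h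
    rw [eA, eB, eH]
    exact h
  · rintro ⟨κ, B, i, hi⟩
    exact basis_ne_of_affine hχ B i (hi.trans eB)
  · rintro ⟨σ, -, hσ⟩
    refine basis_ne_of_affine hχ ((FreeGroupBasis.ofRepr E.symm).map σ.symm) 1 ?_
    rw [FreeGroupBasis.map_apply, ofRepr_symm_apply, σ.symm_apply_eq, ← eB, ← eH, hσ]
  · rw [ofRepr_symm_apply, hET, FreeGroup.map.of]
    fin_cases i
    · exact h1
    · exact h2
    · exact h3
  · have h := forallType_bThree_eq (n := n) hm1
    rw [(IsDiscriminated.of_mulEquiv ET).forallType_eq,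
      (IsDiscriminated.of_mulEquiv ET).forallType_eq, comp_vec_one, comp_vec_one] at h
    rw [eB', eH']
    exact h
  · exact ⟨Fin 3, FreeGroupBasis.ofRepr ET.symm, 0, by rw [ofRepr_symm_apply, eH']⟩
  · rintro ⟨κ, B, i, hi⟩
    exact basis_ne_of_affine hχ' B i (hi.trans eB')
  · rintro ⟨σ, hσ⟩
    refine basis_ne_of_affine hχ' ((FreeGroupBasis.ofRepr ET.symm).map σ.symm) 0 ?_
    rw [FreeGroupBasis.map_apply, ofRepr_symm_apply, σ.symm_apply_eq, ← eB', ← eH', hσ]
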